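/- Let $V$ be a set of $n$ vertices and let $G_0=(V,E_0)$ be an oriented graph, whose edges are initially occupied. Each oriented edge $i\to j$ with $i\neq j$ and $i\to j\notin E_0$ is, independently of the others, open with probability $p_{\rm open}$; let $E_{\rm open}$ be the random set of open edges. For $t\ge 0$ put $$E_{t+1}=E_t\cup\{\,i\to j\in E_{\rm open}:\ i\to k\in E_t \text{ and } k\to j\in E_t\text{ for some }k\in V\,\},\qquad E_\infty=\bigcup_{t\ge0}E_t .$$ Saturation is the event that $E_{\rm open}\subseteq E_\infty$, i.e. every open edge is eventually occupied. For an integer $R\ge1$, call $G_0$ *$R$-unoriented* if there are an (unoriented) tree $T$ on a vertex set $V'$ and a map $\phi:V\to V'$ such that (1) for every $y\in V'$, $|\phi^{-1}(y)|\le R$ and the subgraph of $G_0$ induced by $\phi^{-1}(y)$ is (nonempty and) strongly connected; and (2) for every ordered pair $(y_1,y_2)$ of neighbours in $T$ there are $x_1\in\phi^{-1}(y_1)$ and $x_2\in\phi^{-1}(y_2)$ with $x_1\to x_2\in E_0$. **Theorem.** For every integer $R\ge1$ there is a constant $C_0=C_0(R)$ such that the following holds for every constant $C\ge C_0$. If,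 for all large $n$, $G_0=G_0^{(n)}$ is an $R$-unoriented graph on $n$ vertices and $p_{\rm open}=p_{\rm open}(n)\in[0,1]$ satisfies $$p_{\rm open}\ \ge\ C\,\frac{\log\log n}{\sqrt{\log n}},$$ then the probability of saturation tends to $1$ as $n\to\infty$. -/

import Mathlib

open Filter Topology MeasureTheory ProbabilityTheory

namespace TransClosure

universe u

variable {V : Type u}

/-- The set of oriented edges of an oriented graph; `(i, j)` stands for `i → j`. -/
def edges (G₀ : Digraph V) : Set (V × V) := {e | G₀.Adj e.1 e.2}

/-- The set `E_t` of edges occupied by time `t`, when the initially occupied edges are those of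
`G₀` and the open edges are those in `Eopen`. -/
def occupied (G₀ : Digraph V) (Eopen : Set (V × V)) : ℕ → Set (V × V)
  | 0 => edges G₀
  | t + 1 => occupied G₀ Eopen t ∪
      {e | e ∈ Eopen ∧ ∃ k : V, (e.1, k) ∈ occupied G₀ Eopen t ∧ (k, e.2) ∈ occupied G₀ Eopen t}

/-- The set `E_∞` of eventually occupied edges. -/
def eventuallyOccupied (G₀ : Digraph V) (Eopen : Set (V × V)) : Set (V × V) :=
  ⋃ t : ℕ, occupied G₀ Eopen t

/-- The vertex set `S` is (eventually) saturated: every open edge in `S × S` is eventually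
occupied. -/
def IsSaturated (G₀ : Digraph V) (Eopen : Set (V × V)) (S : Set V) : Prop :=
  ∀ e ∈ Eopen, e ∈ S ×ˢ S → e ∈ eventuallyOccupied G₀ Eopen

/-- The edges that may be open: the oriented edges between distinct vertices that are not
initially occupied. -/
def candidateEdges (G₀ : Digraph V) : Set (V × V) := {e | e.1 ≠ e.2 ∧ e ∉ edges G₀}

/-- The law of the random set of open edges: every edge that may be open is open with
probability `p`, independently of all the others. -/
noncomputable def openLaw (G₀ : Digraph V) (p : unitInterval) : Measure (Set (V × V)) :=
  setBernoulli (candidateEdges G₀) p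

/-- The subgraph of `G₀` induced by `S` is strongly connected: `S` is nonempty, and from every
vertex of `S` to every other there is an oriented path in `G₀` all of whose vertices are in `S`. -/
def StronglyConnectedOn (G₀ : Digraph V) (S : Set V) : Prop :=
  S.Nonempty ∧ ∀ x ∈ S, ∀ y ∈ S,
    Relation.ReflTransGen (fun a b => a ∈ S ∧ b ∈ S ∧ G₀.Adj a b) x y

/-- `G₀` is `R`-unoriented: it is mapped by some `φ` onto the vertices of a tree `T` in such a way
that the fibres of `φ` have at most `R` vertices and are strongly connected, and that there is an
edge of `G₀` from the fibre over `y₁` to the fibre over `y₂` for every ordered pair of neighbours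
`y₁`, `y₂` in `T` (hence, by the symmetry of `T`, one in each direction). -/
def IsRUnoriented (R : ℕ) (G₀ : Digraph V) : Prop :=
  ∃ (V' : Type u) (T : SimpleGraph V') (φ : V → V'), T.IsTree ∧
    (∀ y : V', (φ ⁻¹' {y}).encard ≤ R ∧ StronglyConnectedOn G₀ (φ ⁻¹' {y})) ∧
    ∀ y₁ y₂ : V', T.Adj y₁ y₂ → ∃ x₁ x₂ : V, φ x₁ = y₁ ∧ φ x₂ = y₂ ∧ G₀.Adj x₁ x₂

end TransClosure

/-!
Call a vertex set filled if all the edges within it that are open or initially occupied are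
eventually occupied. A strongly connected set `S` containing a vertex `o` whose edges to and from
the rest of `S` are all open is filled: `o` reaches all of `S` along paths of `G₀`, and everything
else in `S` is obtained by passing through `o`.

A filled set `S` grows. Add to it an adjacent fibre of the tree structure, and let `v → u` be an
occupied edge at one of the new vertices `v`. Then `v → w` becomes occupied if it is open and if an
open path leads from `u` to `w` through the set `N` of open out-neighbours of `v` in `S`. As `N` has
at least about `p |S| / 2` elements, and the absence of such a path means that all the edges across
some cut of `N` are closed, this fails with probability `exp (-Ω(p² |S|))` only; edges into `v` are
treated in the same way, with all orientations reversed. The sum of the errors over all steps is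
small as soon as `|S|` is a large multiple of `log log n / p²`.

It remains to find one starting set of this size, about `m = log n / (8 R log log n)`. There are
about `n / R` candidates with edge-disjoint stars, each of them open with probability at least
`p ^ (2 R m)`, so that one can choose a subfamily in which about `log n` open stars are expected.
With high probability it contains an open star, and by Harris' inequality the star being open does
not make it more likely that its block fails to grow: a union bound over the subfamily costs only
a factor of about `log n`.
-/

namespace TransClosure

section Deterministic

variable {V : Type*} {G₀ : Digraph V} {O ω : Set (V × V)} {S T W : Set V}

/-- `O` is closed under the transitive steps, and contains the loops, that are permitted by `ω`.
The permitted edges will be those that are open or initially occupied. -/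
structure TransitiveWithin (O ω : Set (V × V)) : Prop where
  trans : ∀ a b c, (a, b) ∈ O → (b, c) ∈ O → (a, c) ∈ ω → (a, c) ∈ O
  loop : ∀ a, (a, a) ∈ ω → (a, a) ∈ O

lemma TransitiveWithin.swap (h : TransitiveWithin O ω) :
    TransitiveWithin (Prod.swap ⁻¹' O) (Prod.swap ⁻¹' ω) where
  trans a b c hab hbc hac := h.trans c b a hbc hab hac
  loop a ha := h.loop a ha

/-- The digraph `G₀` with all its edges reversed. -/
def reverse (G₀ : Digraph V) : Digraph V := ⟨fun a b => G₀.Adj b a⟩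

lemma StronglyConnectedOn.reverse (hS : StronglyConnectedOn G₀ S) :
    StronglyConnectedOn (reverse G₀) S :=
  ⟨hS.1, fun x hx y hy => Relation.ReflTransGen.mono (fun _ _ h => ⟨h.2.1, h.1, h.2.2⟩) _ _
    (hS.2 y hy x hx).swap⟩

/-- All the edges from `S` to `W` in `ω` lie in `O`. -/
def Filled (O ω : Set (V × V)) (S W : Set V) : Prop :=
  ∀ a ∈ S, ∀ b ∈ W, (a, b) ∈ ω → (a, b) ∈ O

lemma filled_swap : Filled (Prod.swap ⁻¹' O) (Prod.swap ⁻¹' ω) S W ↔ Filled O ω W S :=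
  ⟨fun h a ha b hb => h b hb a ha, fun h a ha b hb => h b hb a ha⟩

/-- There is an `ω`-path from `u` to `w` all of whose intermediate vertices are `ω`-out-neighbours
of `v` in `S`. Along such a path the occupied edge `v → u` is passed on to `v → w`. -/
def Spreads (S : Set V) (ω : Set (V × V)) (v u w : V) : Prop :=
  Relation.ReflTransGen (fun a b => (a, b) ∈ ω ∧ (b = w ∨ b ∈ S ∧ (v, b) ∈ ω)) u w

lemma Spreads.mono {ω' : Set (V × V)} (hω : ω ⊆ ω') {v u w : V} (h : Spreads S ω v u w) :
    Spreads S ω' v u w :=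
  Relation.ReflTransGen.mono (fun _ _ hab => ⟨hω hab.1, hab.2.imp_right fun hb => ⟨hb.1, hω hb.2⟩⟩)
    _ _ h

lemma Spreads.mem (h : TransitiveWithin O ω) (hSW : S ⊆ W) (hS : Filled O ω S W) {v u w : V}
    (hu : Filled O ω {u} W) (hw : w ∈ W) (hvu : (v, u) ∈ O) (hvw : (v, w) ∈ ω)
    (hs : Spreads S ω v u w) : (v, w) ∈ O := by
  induction hs using Relation.ReflTransGen.head_induction_on with
  | refl => exact hvu
  | @head u b hub _ ih =>
    rcases hub with ⟨hub, rfl | ⟨hbS, hvb⟩⟩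
    · exact h.trans v u b hvu (hu u rfl b hw hub) hvw
    · exact ih (by rintro _ rfl; exact hS _ hbS)
        (h.trans v u b hvu (hu u rfl b (hSW hbS) hub) hvb)

/-- Every vertex of `T` outside `S` spreads, through `S`, from all of `T` to all of `T`. -/
def SpreadsOut (S T : Set V) (ω : Set (V × V)) : Prop :=
  ∀ v ∈ T \ S, ∀ u ∈ T, u ≠ v → ∀ w ∈ T, Spreads S ω v u w

lemma SpreadsOut.mono {ω' : Set (V × V)} (hω : ω ⊆ ω') (h : SpreadsOut S T ω) :
    SpreadsOut S T ω' :=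
  fun v hv u hu huv w hw => (h v hv u hu huv w hw).mono hω

lemma Filled.grow (hS : Filled O ω S W) (h : TransitiveWithin O ω) (hG₀ : edges G₀ ⊆ O)
    (hne : S.Nonempty) (hSW : S ⊆ W) (hWT : W ⊆ T) (hT : StronglyConnectedOn G₀ T)
    (hout : SpreadsOut S T ω) : Filled O ω T W := by
  obtain ⟨s, hs⟩ := hne
  intro v hv
  have hvs := hT.2 v hv s (hWT (hSW hs))
  clear hv
  induction hvs using Relation.ReflTransGen.head_induction_on with
  | refl => exact hS s hs
  | @head v u hvu _ ih =>
    intro w hw hvw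
    by_cases hvS : v ∈ S
    · exact hS v hvS w hw hvw
    by_cases huv : u = v
    · subst huv
      exact ih w hw hvw
    · exact (hout v ⟨hvu.1, hvS⟩ u hvu.2.1 huv w (hWT hw)).mem h hSW hS
        (by rintro _ rfl; exact ih) hw (hG₀ hvu.2.2) hvw

/-- The conditions under which, once `S` is filled, so is the larger set `T`. -/
structure IsGrowthStep (G₀ : Digraph V) (ω : Set (V × V)) (S T : Set V) : Prop where
  subset : S ⊆ T
  stronglyConnectedOn : StronglyConnectedOn G₀ T
  spreadsOut : SpreadsOut S T ω
  spreadsOut_swap : SpreadsOut S T (Prod.swap ⁻¹' ω)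

lemma Filled.of_isGrowthStep (hS : Filled O ω S S) (h : TransitiveWithin O ω) (hG₀ : edges G₀ ⊆ O)
    (hne : S.Nonempty) (hST : IsGrowthStep G₀ ω S T) : Filled O ω T T := by
  have hS_T : Filled O ω S T := filled_swap.1 <|
    (filled_swap.2 hS).grow h.swap (G₀ := reverse G₀) (fun _ he => hG₀ he) hne subset_rfl hST.subset
      hST.stronglyConnectedOn.reverse hST.spreadsOut_swap
  exact hS_T.grow h hG₀ hne hST.subset subset_rfl hST.stronglyConnectedOn hST.spreadsOut

/-- A chain of growth steps leads from `S` to the set of all vertices. -/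
def Grows (G₀ : Digraph V) (S : Set V) (ω : Set (V × V)) : Prop :=
  Relation.ReflTransGen (IsGrowthStep G₀ ω) S Set.univ

lemma Grows.mono {ω' : Set (V × V)} (hω : ω ⊆ ω') (h : Grows G₀ S ω) : Grows G₀ S ω' :=
  Relation.ReflTransGen.mono (fun _ _ hST => ⟨hST.subset, hST.stronglyConnectedOn,
    hST.spreadsOut.mono hω, hST.spreadsOut_swap.mono (Set.preimage_mono hω)⟩) _ _ h

lemma Grows.filled_univ (hgrows : Grows G₀ S ω) (h : TransitiveWithin O ω) (hG₀ : edges G₀ ⊆ O)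
    (hne : S.Nonempty) (hS : Filled O ω S S) : Filled O ω Set.univ Set.univ := by
  induction hgrows using Relation.ReflTransGen.head_induction_on with
  | refl => exact hS
  | head hST _ ih => exact ih (hne.mono hST.subset) (hS.of_isGrowthStep h hG₀ hne hST)

/-- All the edges between `o` and the other vertices of `S`, in both directions. -/
def star (S : Set V) (o : V) : Set (V × V) :=
  ({o} ×ˢ (S \ {o})) ∪ ((S \ {o}) ×ˢ {o})

lemma TransitiveWithin.mem_of_forall_mem (h : TransitiveWithin O ω) (hG₀ : edges G₀ ⊆ O)
    (hS : StronglyConnectedOn G₀ S) {o : V} (ho : o ∈ S) (hω : ∀ x ∈ S, x ≠ o → (o, x) ∈ ω) {x : V}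
    (hx : x ∈ S) (hxo : x ≠ o) : (o, x) ∈ O := by
  have hox := hS.2 o ho x hx
  clear hx
  induction hox with
  | refl => exact absurd rfl hxo
  | @tail a b _ hab ih =>
    by_cases hao : a = o
    · exact hG₀ (hao ▸ hab.2.2)
    · exact h.trans _ _ _ (ih hao) (hG₀ hab.2.2) (hω b hab.2.1 hxo)

lemma filled_of_star_subset (h : TransitiveWithin O ω) (hG₀ : edges G₀ ⊆ O)
    (hS : StronglyConnectedOn G₀ S) {o : V} (ho : o ∈ S) (hstar : star S o ⊆ ω) :
    Filled O ω S S := by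
  have hfrom : ∀ x ∈ S, x ≠ o → (o, x) ∈ O := fun x =>
    h.mem_of_forall_mem hG₀ hS ho fun x hx hxo => hstar (.inl ⟨rfl, hx, hxo⟩)
  have hto : ∀ x ∈ S, x ≠ o → (x, o) ∈ O := fun x =>
    h.swap.mem_of_forall_mem (G₀ := reverse G₀) (fun _ he => hG₀ he) hS.reverse ho
      fun x hx hxo => hstar (.inr ⟨⟨hx, hxo⟩, rfl⟩)
  intro a ha b hb hab
  by_cases hao : a = o <;> by_cases hbo : b = o
  · subst hao hbo
    exact h.loop _ hab
  · exact hao ▸ hfrom b hb hbo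
  · exact hbo ▸ hto a ha hao
  · exact h.trans a o b (hto a ha hao) (hfrom b hb hbo) hab

/-- A strongly connected set grows to the set of all vertices, from a star that is contained in
`ω`. -/
def Nucleates (G₀ : Digraph V) (ω : Set (V × V)) : Prop :=
  ∃ S, StronglyConnectedOn G₀ S ∧ (∃ o ∈ S, star S o ⊆ ω) ∧ Grows G₀ S ω

lemma monotone_occupied (G₀ : Digraph V) (E : Set (V × V)) : Monotone (occupied G₀ E) :=
  monotone_nat_of_le_succ fun _ => Set.subset_union_left

lemma edges_subset_eventuallyOccupied (G₀ : Digraph V) (E : Set (V × V)) :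
    edges G₀ ⊆ eventuallyOccupied G₀ E :=
  Set.subset_iUnion (occupied G₀ E) 0

lemma transitiveWithin_eventuallyOccupied {E : Set (V × V)} (hE : E ⊆ candidateEdges G₀) :
    TransitiveWithin (eventuallyOccupied G₀ E) (edges G₀ ∪ E) where
  trans := by
    rintro a b c hab hbc (hac | hac)
    · exact edges_subset_eventuallyOccupied G₀ E hac
    obtain ⟨s, hs⟩ := Set.mem_iUnion.1 hab
    obtain ⟨t, ht⟩ := Set.mem_iUnion.1 hbc
    exact Set.mem_iUnion.2 ⟨max s t + 1, .inr ⟨hac, b,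
      monotone_occupied G₀ E (le_max_left s t) hs, monotone_occupied G₀ E (le_max_right s t) ht⟩⟩
  loop := by
    rintro a (ha | ha)
    · exact edges_subset_eventuallyOccupied G₀ E ha
    · exact absurd rfl (hE ha).1

lemma Nucleates.isSaturated {E : Set (V × V)} (hE : E ⊆ candidateEdges G₀)
    (h : Nucleates G₀ (edges G₀ ∪ E)) : IsSaturated G₀ E Set.univ := by
  obtain ⟨S, hS, ⟨o, ho, hstar⟩, hgrows⟩ := h
  have htrans := transitiveWithin_eventuallyOccupied hE
  have hG₀ := edges_subset_eventuallyOccupied G₀ E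
  have hfilled := hgrows.filled_univ htrans hG₀ hS.1 (filled_of_star_subset htrans hG₀ hS ho hstar)
  exact fun e he _ => hfilled e.1 trivial e.2 trivial (.inr he)

end Deterministic

section Blocks

variable {V W : Type*} {G₀ : Digraph V} {H : Digraph W} {R m M : ℕ}

lemma StronglyConnectedOn.reflTransGen_of_subset {S T : Set V} (hS : StronglyConnectedOn G₀ S)
    (hST : S ⊆ T) {x y : V} (hx : x ∈ S) (hy : y ∈ S) :
    Relation.ReflTransGen (fun a b => a ∈ T ∧ b ∈ T ∧ G₀.Adj a b) x y :=
  Relation.ReflTransGen.mono (fun _ _ h => ⟨hST h.1, hST h.2.1, h.2.2⟩) _ _ (hS.2 x hx y hy)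

lemma StronglyConnectedOn.exists_adj_of_ssubset {S T : Set V} (hT : StronglyConnectedOn G₀ T)
    (hS : S.Nonempty) (hST : S ⊂ T) : ∃ a ∈ S, ∃ c ∈ T \ S, G₀.Adj a c := by
  obtain ⟨b, hb⟩ := hS
  obtain ⟨p, hp, hpS⟩ := Set.exists_of_ssubset hST
  by_contra! hclosed
  have hbp := hT.2 b (hST.subset hb) p hp
  refine hpS ?_
  clear hp hpS
  induction hbp with
  | refl => exact hb
  | @tail x y _ hxy ih =>
    by_contra hy
    exact hclosed x ih y ⟨hxy.2.1, hy⟩ hxy.2.2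

lemma stronglyConnectedOn_singleton (G₀ : Digraph V) (a : V) : StronglyConnectedOn G₀ {a} := by
  refine ⟨⟨a, rfl⟩, ?_⟩
  rintro x rfl y rfl
  exact .refl

lemma StronglyConnectedOn.insert_of_adj {S : Set V} (hS : StronglyConnectedOn G₀ S) {a c : V}
    (ha : a ∈ S) (hac : G₀.Adj a c) (hca : G₀.Adj c a) : StronglyConnectedOn G₀ (insert c S) := by
  have hpath {x y} := hS.reflTransGen_of_subset (Set.subset_insert c S) (x := x) (y := y)
  refine ⟨⟨c, .inl rfl⟩, ?_⟩
  rintro x (rfl | hx) y (rfl | hy)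
  · exact .refl
  · exact .head ⟨.inl rfl, .inr ha, hca⟩ (hpath ha hy)
  · exact .tail (hpath hx ha) ⟨.inr ha, .inl rfl, hac⟩
  · exact hpath hx hy

lemma StronglyConnectedOn.exists_insert [Std.Symm G₀.Adj] {S T : Set V}
    (hT : StronglyConnectedOn G₀ T) (hS : StronglyConnectedOn G₀ S) (hST : S ⊂ T) :
    ∃ c ∈ T \ S, StronglyConnectedOn G₀ (insert c S) := by
  obtain ⟨a, ha, c, hc, hac⟩ := hT.exists_adj_of_ssubset hS.1 hST
  exact ⟨c, hc, hS.insert_of_adj ha hac (symm hac)⟩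

lemma StronglyConnectedOn.exists_subset_ncard_eq [Finite V] [Std.Symm G₀.Adj] {T : Set V}
    (hT : StronglyConnectedOn G₀ T) {y : V} (hy : y ∈ T) (hm : 1 ≤ m) (hmT : m ≤ T.ncard) :
    ∃ S ⊆ T, y ∈ S ∧ StronglyConnectedOn G₀ S ∧ S.ncard = m := by
  induction m, hm using Nat.le_induction with
  | base => exact ⟨{y}, by simpa using hy, rfl, stronglyConnectedOn_singleton _ _, by simp⟩
  | succ m _ ih =>
    obtain ⟨S, hST, hyS, hS, hcard⟩ := ih (by lia)
    obtain ⟨c, hc, hcS⟩ := hT.exists_insert hS (hST.ssubset_of_ne (by rintro rfl; lia))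
    exact ⟨insert c S, Set.insert_subset hc.1 hST, .inr hyS, hcS, by
      rw [Set.ncard_insert_of_notMem hc.2, hcard]⟩

/-- The sets `B o` for `o ∈ I` are members of `F` of size between `m` and `M`, each with a centre
`o`, such that no two centres belong to each other's sets. The stars about the different centres
then have no edge in common, although the sets themselves may overlap. -/
structure IsCentredFamily (F : Set (Set V)) (m M : ℕ) (I : Finset V) (B : V → Set V) : Prop where
  mem : ∀ o ∈ I, o ∈ B o
  mem_family : ∀ o ∈ I, B o ∈ F
  le_ncard : ∀ o ∈ I, m ≤ (B o).ncard
  ncard_le : ∀ o ∈ I, (B o).ncard ≤ M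
  antisymm : ∀ o ∈ I, ∀ o' ∈ I, o ∈ B o' → o' ∈ B o → o = o'

section CentredFamily

variable {F F' : Set (Set V)} {I : Finset V} {B : V → Set V}

lemma IsCentredFamily.empty (B : V → Set V) : IsCentredFamily F m M ∅ B := by
  constructor <;> simp

lemma IsCentredFamily.mono (h : IsCentredFamily F m M I B) (hF : F ⊆ F') :
    IsCentredFamily F' m M I B :=
  { h with mem_family := fun o ho => hF (h.mem_family o ho) }

lemma IsCentredFamily.insert_update [DecidableEq V] (h : IsCentredFamily F m M I B) {c : V}
    {D : Set V} (hcB : ∀ o ∈ I, c ∉ B o) (hcD : c ∈ D) (hD : D ∈ F) (hmD : m ≤ D.ncard)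
    (hDM : D.ncard ≤ M) : IsCentredFamily F m M (insert c I) (Function.update B c D) := by
  have hB : ∀ o ∈ I, Function.update B c D o = B o := fun o ho =>
    Function.update_of_ne (by rintro rfl; exact hcB o ho (h.mem o ho)) _ _
  constructor <;> simp +contextual only [Finset.forall_mem_insert, Function.update_self, hB]
  · exact ⟨hcD, h.mem⟩
  · exact ⟨hD, h.mem_family⟩
  · exact ⟨hmD, h.le_ncard⟩
  · exact ⟨hDM, h.ncard_le⟩
  · exact ⟨⟨fun _ _ => trivial, fun o ho hco _ => absurd hco (hcB o ho)⟩,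
      fun o ho => ⟨fun _ hco => absurd hco (hcB o ho), h.antisymm o ho⟩⟩

lemma IsCentredFamily.preimage [Finite V] [DecidableEq V] {F : Set (Set W)} {I : Finset W}
    {B : W → Set W} (h : IsCentredFamily F m M I B) {φ : V → W} {g : W → V}
    (hg : Function.RightInverse g φ) (hφ : ∀ Y : Set W, (φ ⁻¹' Y).ncard ≤ R * Y.ncard) :
    IsCentredFamily (Set.preimage φ '' F) m (R * M) (I.image g) (fun o => φ ⁻¹' B (φ o)) := by
  constructor <;> simp only [Finset.forall_mem_image, Set.mem_preimage, hg _]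
  · exact h.mem
  · exact fun o ho => ⟨_, h.mem_family o ho, rfl⟩
  · refine fun o ho => (h.le_ncard o ho).trans ?_
    conv_lhs => rw [← Set.image_preimage_eq (B o) hg.surjective]
    exact Set.ncard_image_le
  · exact fun o ho => (hφ _).trans (Nat.mul_le_mul_left R (h.ncard_le o ho))
  · exact fun o ho o' ho' hoo' ho'o => congrArg g (h.antisymm o ho o' ho' hoo' ho'o)

end CentredFamily

lemma exists_isCentredFamily [Finite V] [Std.Symm G₀.Adj]
    (hV : StronglyConnectedOn G₀ Set.univ) (hm : 1 ≤ m) {k : ℕ} (hmk : m ≤ k)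
    (hk : k ≤ Nat.card V) :
    ∃ (Y : Set V) (I : Finset V) (B : V → Set V), StronglyConnectedOn G₀ Y ∧ Y.ncard = k ∧
      I.card + m = k ∧ IsCentredFamily {S | S ⊆ Y ∧ StronglyConnectedOn G₀ S} m m I B := by
  classical
  induction k, hmk using Nat.le_induction with
  | base =>
    obtain ⟨y, hy⟩ := hV.1
    obtain ⟨Y, -, -, hY, hcard⟩ := hV.exists_subset_ncard_eq hy hm (by rwa [Set.ncard_univ])
    exact ⟨Y, ∅, fun _ => ∅, hY, hcard, by simp, .empty _⟩
  | succ k hmk ih =>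
    obtain ⟨Y, I, B, hY, hYk, hIk, hB⟩ := ih (by lia)
    obtain ⟨c, hc, hY'⟩ := hV.exists_insert hY <| Set.ssubset_univ_iff.2 <| by
      rintro rfl
      rw [Set.ncard_univ] at hYk
      lia
    have hY'k : (insert c Y).ncard = k + 1 := by rw [Set.ncard_insert_of_notMem hc.2, hYk]
    obtain ⟨D, hDY, hcD, hD, hDm⟩ := hY'.exists_subset_ncard_eq (Set.mem_insert c Y) hm
      (by lia)
    have hcB : ∀ o ∈ I, c ∉ B o := fun o ho hco => hc.2 ((hB.mem_family o ho).1 hco)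
    have hBY' : IsCentredFamily {S | S ⊆ insert c Y ∧ StronglyConnectedOn G₀ S} m m I B :=
      hB.mono fun S hS => ⟨hS.1.trans (Set.subset_insert c Y), hS.2⟩
    refine ⟨insert c Y, insert c I, Function.update B c D, hY', hY'k, ?_,
      hBY'.insert_update hcB hcD ⟨hDY, hD⟩ hDm.ge hDm.le⟩
    rw [Finset.card_insert_of_notMem fun hcI => hcB c hcI (hB.mem c hcI), add_right_comm, hIk]

lemma stronglyConnectedOn_preimage {φ : V → W}
    (hfib : ∀ y, StronglyConnectedOn G₀ (φ ⁻¹' {y}))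
    (hedge : ∀ y₁ y₂, H.Adj y₁ y₂ → ∃ x₁ x₂, φ x₁ = y₁ ∧ φ x₂ = y₂ ∧ G₀.Adj x₁ x₂) {Y : Set W}
    (hY : StronglyConnectedOn H Y) : StronglyConnectedOn G₀ (φ ⁻¹' Y) := by
  have hfib_path {a b} (ha : φ a ∈ Y) (hab : φ a = φ b) :=
    (hfib (φ b)).reflTransGen_of_subset (T := φ ⁻¹' Y) (x := a) (y := b)
      (Set.preimage_mono (Set.singleton_subset_iff.2 (hab ▸ ha))) hab rfl
  refine ⟨?_, fun x hx z hz => ?_⟩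
  · obtain ⟨y, hy⟩ := hY.1
    obtain ⟨x, rfl⟩ := (hfib y).1
    exact ⟨x, hy⟩
  have hpath := hY.2 (φ x) hx (φ z) hz
  generalize hc : φ z = c at hpath
  induction hpath generalizing z with
  | refl => exact hfib_path hx hc.symm
  | @tail b c _ hbc ih =>
    obtain ⟨x₁, x₂, rfl, rfl, hx₁x₂⟩ := hedge b c hbc.2.2
    exact ((ih x₁ hbc.1 rfl).tail ⟨hbc.1, hbc.2.1, hx₁x₂⟩).trans (hfib_path hbc.2.1 hc.symm)

lemma ncard_preimage_le [Finite V] [Finite W] {φ : V → W} (hφ : ∀ y, (φ ⁻¹' {y}).ncard ≤ R)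
    (Y : Set W) : (φ ⁻¹' Y).ncard ≤ R * Y.ncard := by
  induction Y, Y.toFinite using Set.Finite.induction_on with
  | empty => simp
  | @insert a s ha _ ih =>
    rw [Set.ncard_insert_of_notMem ha, Set.insert_eq, Set.preimage_union]
    exact (Set.ncard_union_le _ _).trans (by linarith [hφ a])

/-- Every member of `F` is strongly connected, and can be enlarged within `F` by at most `R`
vertices as long as it does not contain all of them. -/
structure IsExhaustion (G₀ : Digraph V) (R : ℕ) (F : Set (Set V)) : Prop where
  stronglyConnectedOn : ∀ S ∈ F, StronglyConnectedOn G₀ S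
  exists_ssuperset : ∀ S ∈ F, S ≠ Set.univ → ∃ T ∈ F, S ⊂ T ∧ (T \ S).ncard ≤ R

lemma isExhaustion_preimage [Finite V] {φ : V → W} (hφ : ∀ y, (φ ⁻¹' {y}).ncard ≤ R)
    (hfib : ∀ y, StronglyConnectedOn G₀ (φ ⁻¹' {y}))
    (hedge : ∀ y₁ y₂, H.Adj y₁ y₂ → ∃ x₁ x₂, φ x₁ = y₁ ∧ φ x₂ = y₂ ∧ G₀.Adj x₁ x₂)
    [Std.Symm H.Adj] (hW : StronglyConnectedOn H Set.univ) :
    IsExhaustion G₀ R (Set.preimage φ '' {Y | StronglyConnectedOn H Y}) where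
  stronglyConnectedOn := by
    rintro _ ⟨Y, hY, rfl⟩
    exact stronglyConnectedOn_preimage hfib hedge hY
  exists_ssuperset := by
    rintro _ ⟨Y, hY, rfl⟩ hne
    obtain ⟨c, hc, hcY⟩ := hW.exists_insert hY
      (Set.ssubset_univ_iff.2 (by rintro rfl; exact hne rfl))
    refine ⟨_, ⟨insert c Y, hcY, rfl⟩, ⟨Set.preimage_mono (Set.subset_insert c Y), fun hsub => ?_⟩,
      (Set.ncard_le_ncard ?_).trans (hφ c)⟩
    · obtain ⟨x, rfl⟩ := (hfib c).1
      exact hc.2 (hsub (.inl rfl))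
    · exact fun x hx => hx.1.resolve_right hx.2

lemma stronglyConnectedOn_univ {T : SimpleGraph W} (hT : T.Connected) :
    StronglyConnectedOn ⟨T.Adj⟩ Set.univ := by
  obtain ⟨w⟩ := hT.nonempty
  exact ⟨⟨w, trivial⟩, fun x _ y _ => Relation.ReflTransGen.mono
    (fun _ _ hab => ⟨trivial, trivial, hab⟩) _ _
    ((SimpleGraph.reachable_iff_reflTransGen x y).1 (hT.preconnected x y))⟩

lemma IsRUnoriented.exists_isExhaustion_isCentredFamily [Finite V] (h : IsRUnoriented R G₀)
    (hm : 1 ≤ m) : ∃ (F : Set (Set V)) (I : Finset V) (B : V → Set V), IsExhaustion G₀ R F ∧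
      IsCentredFamily F m (R * m) I B ∧ Nat.card V ≤ R * (I.card + m) := by
  classical
  obtain ⟨W, T, φ, hT, hfib, hedge⟩ := h
  have hR : ∀ y, (φ ⁻¹' {y}).ncard ≤ R := fun y => by
    have hy := (hfib y).1
    rwa [← (Set.toFinite _).cast_ncard_eq, Nat.cast_le] at hy
  obtain ⟨g, hg⟩ := Function.Surjective.hasRightInverse (f := φ) fun y => (hfib y).2.1
  have : Finite W := Finite.of_surjective φ hg.surjective
  have : Std.Symm (⟨T.Adj⟩ : Digraph W).Adj := T.symm
  have hW := stronglyConnectedOn_univ hT.1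
  have hV : Nat.card V ≤ R * Nat.card W := by
    simpa [Set.ncard_univ] using ncard_preimage_le hR Set.univ
  suffices ∃ (I : Finset W) (B : W → Set W),
      IsCentredFamily {Y | StronglyConnectedOn ⟨T.Adj⟩ Y} m m I B ∧ Nat.card W ≤ I.card + m by
    obtain ⟨I, B, hB, hI⟩ := this
    refine ⟨_, I.image g, _, isExhaustion_preimage hR (fun y => (hfib y).2) hedge hW,
      hB.preimage hg (ncard_preimage_le hR), hV.trans (Nat.mul_le_mul_left R ?_)⟩
    rwa [Finset.card_image_of_injective _ hg.injective]
  obtain hmW | hmW := le_or_gt m (Nat.card W)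
  · obtain ⟨_, I, B, -, -, hI, hB⟩ := exists_isCentredFamily hW hm hmW le_rfl
    exact ⟨I, B, hB.mono fun S hS => hS.2, hI.ge⟩
  · exact ⟨∅, fun _ => ∅, .empty _, by simpa using hmW.le⟩

end Blocks

section RandomSet

lemma measureReal_le_add_of_forall_fiber {Ω β : Type*} [MeasurableSpace Ω] {μ : Measure Ω}
    [IsProbabilityMeasure μ] [Finite β] {f : Ω → β} (hf : ∀ b, MeasurableSet (f ⁻¹' {b}))
    (S : Set β) (U : Set Ω) {ε : ℝ} (hε : 0 ≤ ε)
    (h : ∀ b ∉ S, μ.real (f ⁻¹' {b} ∩ U) ≤ μ.real (f ⁻¹' {b}) * ε) :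
    μ.real U ≤ μ.real (f ⁻¹' S) + ε := by
  classical
  have := Fintype.ofFinite β
  have hcover : U ⊆ f ⁻¹' S ∪ ⋃ b ∈ ({b | b ∉ S} : Finset β), f ⁻¹' {b} ∩ U := by
    intro ω hω
    by_cases hS : f ω ∈ S
    · exact Or.inl hS
    · exact Or.inr (Set.mem_biUnion (x := f ω) (by simpa using hS) ⟨rfl, hω⟩)
  have htotal : ∑ b ∈ ({b | b ∉ S} : Finset β), μ.real (f ⁻¹' {b}) ≤ 1 := by
    rw [sum_measureReal_preimage_singleton _ fun b _ => hf b]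
    exact measureReal_le_one
  calc μ.real U
      ≤ μ.real (f ⁻¹' S) + ∑ b ∈ ({b | b ∉ S} : Finset β), μ.real (f ⁻¹' {b} ∩ U) :=
        (measureReal_mono hcover).trans <| (measureReal_union_le _ _).trans <|
          add_le_add_right (measureReal_biUnion_finset_le _ _) _
    _ ≤ μ.real (f ⁻¹' S) + ∑ b ∈ ({b | b ∉ S} : Finset β), μ.real (f ⁻¹' {b}) * ε := by
        gcongr with b hb
        exact h b (by simpa using hb)
    _ ≤ μ.real (f ⁻¹' S) + ε := by
        rw [← Finset.sum_mul]
        exact add_le_add_right (mul_le_of_le_one_left hε htotal) _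

/-- A form of Hoeffding's inequality. -/
lemma measureReal_card_filter_le_exp {Ω ι : Type*} [MeasurableSpace Ω] {μ : Measure Ω}
    [IsProbabilityMeasure μ] {A : ι → Set Ω} (hA : ∀ i, MeasurableSet (A i)) (hind : iIndepSet A μ)
    [∀ ω, DecidablePred (ω ∈ A ·)]
    {q : ℝ} (hq : 0 ≤ q) (D : Finset ι) (hD : ∀ i ∈ D, q ≤ μ.real (A i)) :
    μ.real {ω | ((D.filter (ω ∈ A ·)).card : ℝ) ≤ q * D.card / 2} ≤
      Real.exp (-(q ^ 2 * D.card / 2)) := by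
  let X : ι → Ω → ℝ := fun i => (A i).indicator 1
  let Y : ι → Ω → ℝ := fun i ω => μ.real (A i) - X i ω
  have hX : ∀ i, Measurable (X i) := fun i => measurable_one.indicator (hA i)
  have hmean : ∀ i, μ[X i] = μ.real (A i) := fun i => integral_indicator_one (hA i)
  have hY : iIndepFun Y μ :=
    hind.iIndepFun_indicator.comp (fun i x => μ.real (A i) - x) fun i => by fun_prop
  have hsubG : ∀ i ∈ D, HasSubgaussianMGF (Y i) (1 / 4) μ := fun i _ => by
    have h := (hasSubgaussianMGF_of_mem_Icc (μ := μ) (a := 0) (b := 1) (hX i).aemeasurable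
      (ae_of_all _ fun ω => by by_cases hω : ω ∈ A i <;> simp [X, hω])).neg
    convert h using 1
    · ext ω
      simp [Y, hmean]
    · ext
      norm_num
  have hsum : ∀ ω, ∑ i ∈ D, Y i ω = ∑ i ∈ D, μ.real (A i) - (D.filter (ω ∈ A ·)).card := by
    intro ω
    simp only [Y, Finset.sum_sub_distrib, X, Set.indicator_apply, Pi.one_apply, Finset.sum_boole]
  calc μ.real {ω | ((D.filter (ω ∈ A ·)).card : ℝ) ≤ q * D.card / 2}
      ≤ μ.real {ω | q * D.card / 2 ≤ ∑ i ∈ D, Y i ω} := by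
        refine measureReal_mono fun ω hω => ?_
        have hqD : q * D.card ≤ ∑ i ∈ D, μ.real (A i) := by
          simpa [mul_comm] using Finset.card_nsmul_le_sum D _ q hD
        simp only [Set.mem_ofPred_eq, hsum] at hω ⊢
        linarith
    _ ≤ Real.exp (-(q * D.card / 2) ^ 2 / (2 * ∑ _i ∈ D, (1 / 4 : NNReal))) := by
        exact_mod_cast HasSubgaussianMGF.measure_sum_ge_le_of_iIndepFun hY hsubG (by positivity)
    _ = Real.exp (-(q ^ 2 * D.card / 2)) := by
        rcases D.card.eq_zero_or_pos with h0 | hpos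
        · simp [h0]
        · congr 1
          have : (0 : ℝ) < D.card := by exact_mod_cast hpos
          simp
          field_simp
          norm_num

variable {E : Type*}

/-- Membership of `ω` in the event `U` only depends on the elements of `D` that `ω` contains. -/
def DeterminedBy (U : Set (Set E)) (D : Set E) : Prop :=
  ∀ ω, ω ∈ U ↔ ω ∩ D ∈ U

lemma DeterminedBy.mono {U : Set (Set E)} {D D' : Set E} (h : DeterminedBy U D) (hD : D ⊆ D') :
    DeterminedBy U D' := fun ω => by
  rw [h ω, h (ω ∩ D'), Set.inter_assoc, Set.inter_eq_right.2 hD]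

lemma DeterminedBy.compl {U : Set (Set E)} {D : Set E} (h : DeterminedBy U D) :
    DeterminedBy Uᶜ D :=
  fun ω => not_congr (h ω)

lemma DeterminedBy.biInter {J : Type*} {I : Finset J} {U : J → Set (Set E)} {D : Set E}
    (h : ∀ j ∈ I, DeterminedBy (U j) D) : DeterminedBy (⋂ j ∈ I, U j) D := fun ω => by
  simp only [Set.mem_iInter]
  exact forall₂_congr fun j hj => h j hj ω

lemma determinedBy_superset (D : Set E) : DeterminedBy {ω | D ⊆ ω} D := fun ω => by
  simp

lemma determinedBy_disjoint (D : Set E) : DeterminedBy {ω | Disjoint D ω} D := fun ω => by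
  rw [Set.mem_ofPred_eq, Set.mem_ofPred_eq, Set.disjoint_iff_inter_eq_empty,
    Set.disjoint_iff_inter_eq_empty, Set.inter_left_comm, Set.inter_self, Set.inter_comm]

lemma determinedBy_fiber {β : Type*} {f : Set E → β} {D : Set E} (hf : ∀ ω, f ω = f (ω ∩ D))
    (b : β) : DeterminedBy (f ⁻¹' {b}) D := fun ω => by
  rw [Set.mem_preimage, Set.mem_preimage, ← hf]

lemma DeterminedBy.measurableSet [Finite E] {U : Set (Set E)} {D : Set E} (h : DeterminedBy U D) :
    MeasurableSet[MeasurableSpace.generateFrom {t | ∃ e ∈ D, {ω : Set E | e ∈ ω} = t}] U := by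
  have hmeas : Measurable[.generateFrom {t | ∃ e ∈ D, {ω : Set E | e ∈ ω} = t}]
      (· ∩ D : Set E → Set E) := by
    refine (@measurable_set_iff _ _ (_) _).2 fun e => (@measurableSet_setOfPred _ (_) _).1 ?_
    by_cases he : e ∈ D
    · exact MeasurableSpace.measurableSet_generateFrom ⟨e, he, by simp [he]⟩
    · simp [he]
  rw [show U = (· ∩ D) ⁻¹' U from Set.ext h]
  exact hmeas .of_discrete

/-- The random set with law `μ` contains the different elements of `E` independently. -/
def IndepMem (μ : Measure (Set E)) : Prop :=
  iIndepSet (fun e => {ω : Set E | e ∈ ω}) μ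

section Independence

variable [Finite E] {μ : Measure (Set E)}

lemma IndepMem.real_inter_eq_mul (hμ : IndepMem μ) {D D' : Set E} (hD : Disjoint D D')
    {U U' : Set (Set E)} (hU : DeterminedBy U D) (hU' : DeterminedBy U' D') :
    μ.real (U ∩ U') = μ.real U * μ.real U' := by
  have h := iIndepSet.indep_generateFrom_of_disjoint (fun _ => .of_discrete) hμ D D' hD
  simp [measureReal_def, (Indep_iff _ _ _).1 h U U' hU.measurableSet hU'.measurableSet]

variable [IsProbabilityMeasure μ]

lemma IndepMem.real_biInter_eq_prod (hμ : IndepMem μ) {J : Type*} {I : Finset J}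
    {U : J → Set (Set E)} {D : J → Set E} (hU : ∀ j ∈ I, DeterminedBy (U j) (D j))
    (hD : (I : Set J).PairwiseDisjoint D) :
    μ.real (⋂ j ∈ I, U j) = ∏ j ∈ I, μ.real (U j) := by
  classical
  induction I using Finset.induction_on with
  | empty => simp
  | insert a s ha ih =>
    have hrest : DeterminedBy (⋂ j ∈ s, U j) (⋃ j ∈ s, D j) := .biInter fun j hj =>
      (hU j (Finset.mem_insert_of_mem hj)).mono
        (Set.subset_biUnion_of_mem (u := D) (Finset.mem_coe.2 hj))
    have hdisj : Disjoint (D a) (⋃ j ∈ s, D j) := by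
      simp only [Set.disjoint_iUnion_right]
      exact fun j hj => hD (by simp) (by simp [hj]) (by rintro rfl; exact ha hj)
    rw [Finset.set_biInter_insert, Finset.prod_insert ha,
      hμ.real_inter_eq_mul hdisj (hU a (Finset.mem_insert_self _ _)) hrest,
      ih (fun j hj => hU j (Finset.mem_insert_of_mem hj)) (hD.subset (by simp))]

/-- A special case of Harris' inequality. -/
lemma IndepMem.real_superset_inter_le (hμ : IndepMem μ) (D : Set E) {L : Set (Set E)}
    (hL : IsLowerSet L) : μ.real ({ω | D ⊆ ω} ∩ L) ≤ μ.real {ω | D ⊆ ω} * μ.real L := by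
  have hforced : {ω | D ⊆ ω} ∩ L ⊆ {ω | D ⊆ ω} ∩ {ω | ω ∪ D ∈ L} := by
    rintro ω ⟨hD, hω⟩
    exact ⟨hD, by rwa [Set.mem_ofPred_eq, Set.union_eq_self_of_subset_right hD]⟩
  have hdet : DeterminedBy {ω | ω ∪ D ∈ L} Dᶜ := fun ω => by
    rw [Set.mem_ofPred_eq, Set.mem_ofPred_eq, Set.inter_union_distrib_right, Set.compl_union_self,
      Set.inter_univ]
  calc μ.real ({ω | D ⊆ ω} ∩ L) ≤ μ.real ({ω | D ⊆ ω} ∩ {ω | ω ∪ D ∈ L}) := measureReal_mono hforced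
    _ = μ.real {ω | D ⊆ ω} * μ.real {ω | ω ∪ D ∈ L} :=
        hμ.real_inter_eq_mul disjoint_compl_right (determinedBy_superset D) hdet
    _ ≤ μ.real {ω | D ⊆ ω} * μ.real L :=
        mul_le_mul_of_nonneg_left (measureReal_mono fun _ hω => hL Set.subset_union_left hω)
          measureReal_nonneg

end Independence

/-- The random set with law `μ` contains the different elements of `E` independently, each element
of `u` with probability at least `q`. -/
structure DominatesBernoulli (μ : Measure (Set E)) (u : Set E) (q : ℝ) : Prop where
  indepMem : IndepMem μ
  le_real_mem : ∀ e ∈ u, q ≤ μ.real {ω | e ∈ ω}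

namespace DominatesBernoulli

lemma mono {μ : Measure (Set E)} {u : Set E} {q q' : ℝ} (hμ : DominatesBernoulli μ u q)
    (h : q' ≤ q) : DominatesBernoulli μ u q' :=
  ⟨hμ.indepMem, fun e he => h.trans (hμ.le_real_mem e he)⟩

variable [Finite E] {μ : Measure (Set E)} [IsProbabilityMeasure μ] {u : Set E} {q : ℝ}

lemma pow_ncard_le_real_superset (hμ : DominatesBernoulli μ u q) (hq : 0 ≤ q) {D : Set E}
    (hD : D ⊆ u) : q ^ D.ncard ≤ μ.real {ω | D ⊆ ω} := by
  lift D to Finset E using D.toFinite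
  have hinter : {ω : Set E | (D : Set E) ⊆ ω} = ⋂ e ∈ D, {ω | {e} ⊆ ω} := by
    ext; simp [Set.subset_def]
  rw [hinter, hμ.indepMem.real_biInter_eq_prod (fun e _ => determinedBy_superset {e})
    fun _ _ _ _ h => Set.disjoint_singleton.2 h, Set.ncard_coe_finset, ← Finset.prod_const]
  exact Finset.prod_le_prod (fun _ _ => hq) fun e he => by simpa using hμ.le_real_mem e (hD he)

lemma real_disjoint_le_pow_ncard (hμ : DominatesBernoulli μ u q) {D : Set E} (hD : D ⊆ u) :
    μ.real {ω | Disjoint D ω} ≤ (1 - q) ^ D.ncard := by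
  lift D to Finset E using D.toFinite
  have hinter : {ω : Set E | Disjoint (D : Set E) ω} = ⋂ e ∈ D, {ω | {e} ⊆ ω}ᶜ := by
    ext; simp [Set.disjoint_left]
  rw [hinter, hμ.indepMem.real_biInter_eq_prod (fun e _ => (determinedBy_superset {e}).compl)
    fun _ _ _ _ h => Set.disjoint_singleton.2 h, Set.ncard_coe_finset, ← Finset.prod_const]
  refine Finset.prod_le_prod (fun _ _ => measureReal_nonneg) fun e he => ?_
  rw [probReal_compl_eq_one_sub .of_discrete]
  simpa only [Set.singleton_subset_iff] using sub_le_sub_left (hμ.le_real_mem e (hD he)) 1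

end DominatesBernoulli

lemma IndepMem.map_preimage [Finite E] {E' : Type*} [Finite E'] {μ : Measure (Set E)}
    (hμ : IndepMem μ) {g : E' → E} (hg : g.Injective) : IndepMem (μ.map (g ⁻¹' ·)) := by
  refine (iIndepSet_iff_meas_biInter fun _ => .of_discrete).2 fun s => ?_
  simp only [Measure.map_apply .of_discrete .of_discrete, Set.preimage_iInter]
  exact iIndepSet.meas_biInter (iIndepSet.precomp hg hμ) s

lemma IndepMem.map_union_left [Finite E] {μ : Measure (Set E)} [IsProbabilityMeasure μ]
    (hμ : IndepMem μ) (D : Set E) : IndepMem (μ.map (D ∪ ·)) := by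
  classical
  refine (iIndepSet_iff_meas_biInter fun _ => .of_discrete).2 fun s => ?_
  simp only [Measure.map_apply .of_discrete .of_discrete, Set.preimage_iInter]
  have hinter : ⋂ e ∈ s, (D ∪ ·) ⁻¹' {ω | e ∈ ω} = ⋂ e ∈ s.filter (· ∉ D), {ω : Set E | e ∈ ω} := by
    ext ω
    simp [or_iff_not_imp_left]
  rw [hinter, iIndepSet.meas_biInter hμ, Finset.prod_filter]
  refine Finset.prod_congr rfl fun e _ => ?_
  by_cases he : e ∈ D <;> simp [he]

section SetBernoulli

variable (p : unitInterval) (u : Set E)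

lemma setBernoulli_mem (e : E) : setBernoulli u p {ω | e ∈ ω} =
    (unitInterval.toNNReal p • Measure.dirac (e ∈ u) +
      unitInterval.toNNReal (unitInterval.symm p) • Measure.dirac False) {True} := by
  rw [setBernoulli_apply', ← (measurePreserving_eval_infinitePi (fun i : E =>
    unitInterval.toNNReal p • Measure.dirac (i ∈ u) +
      unitInterval.toNNReal (unitInterval.symm p) • Measure.dirac False) e).measure_preimage
      (MeasurableSet.nullMeasurableSet .of_discrete)]
  congr 1
  ext
  simp

lemma indepMem_setBernoulli [Finite E] : IndepMem (setBernoulli u p) := by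
  refine (iIndepSet_iff_meas_biInter fun _ => .of_discrete).2 fun s => ?_
  simp only [setBernoulli_mem]
  rw [setBernoulli_apply', ← Measure.infinitePi_pi _ fun _ _ => .of_discrete]
  congr 1
  ext
  simp [Set.mem_pi]

lemma setBernoulli_real_mem {e : E} (he : e ∈ u) : (setBernoulli u p).real {ω | e ∈ ω} = p := by
  simp [measureReal_def, setBernoulli_mem, he]

end SetBernoulli

end RandomSet

section Spreading

lemma one_sub_pow_mul_le {q : ℝ} (hq : 0 ≤ q) (hq1 : q ≤ 1) {a b : ℕ} (hba : b ≤ a) :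
    (1 - q) ^ ((a + 1) * (b + 1)) ≤ Real.exp (-(q * (a + b : ℕ) / 2)) ^ (b + 1) := by
  have hba' : (b : ℝ) ≤ a := by exact_mod_cast hba
  calc (1 - q) ^ ((a + 1) * (b + 1))
      ≤ Real.exp (-q) ^ ((a + 1) * (b + 1)) :=
        pow_le_pow_left₀ (by linarith) (Real.one_sub_le_exp_neg q) _
    _ = Real.exp (-(q * (a + 1))) ^ (b + 1) := by
        rw [pow_mul, ← Real.exp_nat_mul]
        push_cast
        ring_nf
    _ ≤ Real.exp (-(q * (a + b : ℕ) / 2)) ^ (b + 1) := by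
        gcongr
        push_cast
        nlinarith

lemma sum_one_sub_pow_mul_le {α : Type*} (N : Finset α) {q : ℝ} (hq : 0 ≤ q) (hq1 : q ≤ 1) :
    ∑ A ∈ N.powerset, (1 - q) ^ ((N.card - A.card + 1) * (A.card + 1)) ≤
      2 * Real.exp (-(q * N.card / 2)) * (1 + Real.exp (-(q * N.card / 2))) ^ N.card := by
  set y := Real.exp (-(q * N.card / 2)) with hy
  have : 0 < y := Real.exp_pos _
  have hterm : ∀ A ∈ N.powerset, (1 - q) ^ ((N.card - A.card + 1) * (A.card + 1)) ≤
      y * (y ^ A.card * 1 ^ (N.card - A.card) + 1 ^ A.card * y ^ (N.card - A.card)) := by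
    intro A hA
    have hAN := Finset.card_le_card (Finset.mem_powerset.1 hA)
    rw [one_pow, one_pow, mul_one, one_mul, mul_add y, ← pow_succ', ← pow_succ']
    rcases le_total A.card (N.card - A.card) with h | h
    · have hle := one_sub_pow_mul_le hq hq1 h
      rw [Nat.sub_add_cancel hAN, ← hy] at hle
      exact le_add_of_le_of_nonneg hle (by positivity)
    · have hle := one_sub_pow_mul_le hq hq1 h
      rw [Nat.add_sub_of_le hAN, ← hy, mul_comm] at hle
      exact le_add_of_nonneg_of_le (by positivity) hle
  calc ∑ A ∈ N.powerset, (1 - q) ^ ((N.card - A.card + 1) * (A.card + 1))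
      ≤ ∑ A ∈ N.powerset,
          y * (y ^ A.card * 1 ^ (N.card - A.card) + 1 ^ A.card * y ^ (N.card - A.card)) :=
        Finset.sum_le_sum hterm
    _ = 2 * y * (1 + y) ^ N.card := by
        rw [← Finset.mul_sum, Finset.sum_add_distrib, Finset.sum_pow_mul_eq_add_pow,
          Finset.sum_pow_mul_eq_add_pow]
        ring

lemma two_mul_exp_mul_pow_le {q x : ℝ} (hq : 0 < q) (hqx : 4 / q ≤ Real.exp (x / 2)) {n : ℕ}
    (hn : 2 * x ≤ q * n) :
    2 * Real.exp (-(q * n / 2)) * (1 + Real.exp (-(q * n / 2))) ^ n ≤ 6 * Real.exp (-x) := by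
  set y := Real.exp (-(q * n / 2)) with hy
  have hyx : y ≤ Real.exp (-x) := Real.exp_le_exp.2 (by linarith)
  have hny : n * y ≤ 1 := by
    have hleft : n * Real.exp (-(q * n / 4)) ≤ 4 / q := by
      rw [Real.exp_neg, ← div_eq_mul_inv, div_le_div_iff₀ (Real.exp_pos _) hq]
      linarith [Real.add_one_le_exp (q * n / 4)]
    have hright : Real.exp (-(q * n / 4)) ≤ q / 4 := by
      rw [Real.exp_neg, inv_le_comm₀ (Real.exp_pos _) (by positivity), inv_div]
      exact hqx.trans (Real.exp_le_exp.2 (by linarith))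
    calc n * y = n * Real.exp (-(q * n / 4)) * Real.exp (-(q * n / 4)) := by
          rw [hy, mul_assoc, ← Real.exp_add]
          ring_nf
      _ ≤ 4 / q * (q / 4) := by gcongr
      _ = 1 := by field_simp
  have hpow : (1 + y) ^ n ≤ 3 := by
    calc (1 + y) ^ n ≤ Real.exp y ^ n := by
          gcongr
          linarith [Real.add_one_le_exp y]
      _ = Real.exp (n * y) := (Real.exp_nat_mul _ _).symm
      _ ≤ Real.exp 1 := Real.exp_le_exp.2 hny
      _ ≤ 3 := by linarith [Real.exp_one_lt_d9]
  calc 2 * y * (1 + y) ^ n ≤ 2 * Real.exp (-x) * 3 := by gcongr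
    _ = 6 * Real.exp (-x) := by ring

variable {V : Type*} {S T : Set V} {v u w : V}

/-- The edges from `u` and `N \ A` to `w` and `A`. If `ω` contains none of them, then no path in `ω`
leads from `u` to `w` through `N`. -/
def cut (N A : Set V) (u w : V) : Set (V × V) :=
  insert u (N \ A) ×ˢ insert w A

lemma exists_disjoint_cut_of_not_spreads {ω : Set (V × V)} (h : ¬ Spreads S ω v u w)
    {N : Finset V} (hN : ∀ k ∈ N, k ∈ S ∧ (v, k) ∈ ω) : ∃ A ⊆ N, Disjoint (cut ↑N ↑A u w) ω := by
  classical
  let reachable : V → Prop :=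
    Relation.ReflTransGen (fun a b => (a, b) ∈ ω ∧ (b = w ∨ b ∈ S ∧ (v, b) ∈ ω)) u
  refine ⟨N.filter (¬ reachable ·), Finset.filter_subset _ _, Set.disjoint_left.2 ?_⟩
  rintro ⟨a, b⟩ ⟨ha, hb⟩ hab
  have ha_reachable : reachable a := by
    rcases ha with (rfl : a = u) | ⟨haN, ha⟩
    · exact .refl
    · by_contra hna
      exact ha (by simpa using ⟨haN, hna⟩)
  rcases hb with (rfl : b = w) | hb
  · exact h (ha_reachable.tail ⟨hab, .inl rfl⟩)
  · obtain ⟨hbN, hb_unreachable⟩ := Finset.mem_filter.1 (Finset.mem_coe.1 hb)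
    exact hb_unreachable (ha_reachable.tail ⟨hab, .inr (hN b hbN)⟩)

lemma disjoint_cut {N : Set V} (A : Set V) (hv : v ∉ N) (huv : u ≠ v) :
    Disjoint {e | e.1 = v} (cut N A u w) := by
  refine Set.disjoint_left.2 ?_
  rintro ⟨a, b⟩ (rfl : a = v) ⟨rfl | ha, -⟩
  · exact huv rfl
  · exact hv ha.1

lemma cut_subset_compl_diagonal {N A : Set V} (hA : A ⊆ N) (hu : u ∉ N) (hw : w ∉ N)
    (huw : u ≠ w) : cut N A u w ⊆ (Set.diagonal V)ᶜ := by
  rintro ⟨a, b⟩ ⟨ha, hb⟩ (rfl : a = b)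
  rcases ha, hb with ⟨rfl | ha, rfl | hb⟩
  · exact huw rfl
  · exact hu (hA hb)
  · exact hw ha.1
  · exact ha.2 hb

lemma ncard_cut {N A : Finset V} (hA : A ⊆ N) (hu : u ∉ N) (hw : w ∉ N) :
    (cut ↑N ↑A u w).ncard = (N.card - A.card + 1) * (A.card + 1) := by
  rw [cut, Set.ncard_prod, Set.ncard_insert_of_notMem (fun h => hu h.1) (N.finite_toSet.sdiff),
    Set.ncard_insert_of_notMem (fun h => hw (hA h)), Set.ncard_sdiff (Finset.coe_subset.2 hA),
    Set.ncard_coe_finset, Set.ncard_coe_finset]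

/-- The out-neighbours of `v` in `K`, in the digraph with edge set `ω`. -/
noncomputable def outNeighbors (K : Finset V) (v : V) (ω : Set (V × V)) : Finset V :=
  open Classical in K.filter fun k => (v, k) ∈ ω

lemma mem_outNeighbors {K : Finset V} {ω : Set (V × V)} {k : V} :
    k ∈ outNeighbors K v ω ↔ k ∈ K ∧ (v, k) ∈ ω := by
  simp [outNeighbors]

variable [Finite V] {μ : Measure (Set (V × V))} [IsProbabilityMeasure μ] {q : ℝ}

lemma real_fiber_inter_not_spreads_le (hμ : DominatesBernoulli μ (Set.diagonal V)ᶜ q) (hq0 : 0 ≤ q)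
    (hq1 : q ≤ 1) (hv : v ∉ S) (huv : u ≠ v) (huw : u ≠ w) {K N : Finset V}
    (hK : (K : Set V) ⊆ S \ {u, w}) (hN : N ⊆ K) :
    μ.real (outNeighbors K v ⁻¹' {N} ∩ {ω | ¬ Spreads S ω v u w}) ≤
      μ.real (outNeighbors K v ⁻¹' {N}) *
        (2 * Real.exp (-(q * N.card / 2)) * (1 + Real.exp (-(q * N.card / 2))) ^ N.card) := by
  set X := outNeighbors K v ⁻¹' {N}
  have hNS : ∀ k ∈ N, k ∈ S := fun k hk => (hK (hN hk)).1
  have hu : u ∉ N := fun h => (hK (hN h)).2 (.inl rfl)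
  have hw : w ∉ N := fun h => (hK (hN h)).2 (.inr rfl)
  have hX_det : DeterminedBy X {e | e.1 = v} := determinedBy_fiber (fun ω => by
    ext
    simp [mem_outNeighbors]) N
  have hcover : X ∩ {ω | ¬ Spreads S ω v u w} ⊆
      ⋃ A ∈ N.powerset, X ∩ {ω | Disjoint (cut ↑N ↑A u w) ω} := by
    rintro ω ⟨hω, hs⟩
    obtain ⟨A, hA, hcut⟩ := exists_disjoint_cut_of_not_spreads hs (N := N) fun k hk =>
      ⟨hNS k hk, (mem_outNeighbors.1 (hω.symm ▸ hk)).2⟩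
    exact Set.mem_biUnion (Finset.mem_coe.2 (Finset.mem_powerset.2 hA)) ⟨hω, hcut⟩
  calc μ.real (X ∩ {ω | ¬ Spreads S ω v u w})
      ≤ ∑ A ∈ N.powerset, μ.real (X ∩ {ω | Disjoint (cut ↑N ↑A u w) ω}) :=
        (measureReal_mono hcover (measure_ne_top _ _)).trans <|
          measureReal_biUnion_finset_le _ _
    _ ≤ ∑ A ∈ N.powerset, μ.real X * (1 - q) ^ ((N.card - A.card + 1) * (A.card + 1)) := by
        refine Finset.sum_le_sum fun A hA => ?_
        have hAN := Finset.mem_powerset.1 hA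
        rw [hμ.indepMem.real_inter_eq_mul (disjoint_cut _ (fun h => hv (hNS v h)) huv) hX_det
          (determinedBy_disjoint _), ← ncard_cut hAN hu hw]
        exact mul_le_mul_of_nonneg_left (hμ.real_disjoint_le_pow_ncard
          (cut_subset_compl_diagonal (Finset.coe_subset.2 hAN) hu hw huw)) measureReal_nonneg
    _ ≤ _ := by
        rw [← Finset.mul_sum]
        exact mul_le_mul_of_nonneg_left (sum_one_sub_pow_mul_le N hq0 hq1) measureReal_nonneg

lemma real_card_outNeighbors_le_exp (hμ : DominatesBernoulli μ (Set.diagonal V)ᶜ q) (hq : 0 ≤ q)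
    {K : Finset V} (hv : v ∉ K) :
    μ.real {ω | ((outNeighbors K v ω).card : ℝ) ≤ q * K.card / 2} ≤
      Real.exp (-(q ^ 2 * K.card / 2)) := by
  classical
  exact measureReal_card_filter_le_exp (A := fun k => {ω : Set (V × V) | (v, k) ∈ ω})
    (fun _ => .of_discrete) (hμ.indepMem.precomp (Prod.mk_right_injective v)) hq K
    fun k hk => hμ.le_real_mem (v, k) fun h : v = k => hv (h ▸ hk)

lemma real_not_spreads_le (hμ : DominatesBernoulli μ (Set.diagonal V)ᶜ q) (hq0 : 0 < q)
    (hq1 : q ≤ 1) (hv : v ∉ S) (huv : u ≠ v) (hS : 4 ≤ S.ncard)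
    (hlarge : 4 / q ≤ Real.exp (q ^ 2 * S.ncard / 16)) :
    μ.real {ω | ¬ Spreads S ω v u w} ≤ 7 * Real.exp (-(q ^ 2 * S.ncard / 8)) := by
  rcases eq_or_ne u w with rfl | huw
  · have hspreads : ∀ ω, Spreads S ω v u u := fun ω => .refl
    simp only [hspreads, not_true_eq_false, Set.ofPred_false, measureReal_empty]
    positivity
  obtain ⟨K, hK⟩ := (S \ {u, w}).toFinite.exists_finset_coe
  have hKS : (K : Set V) ⊆ S := hK ▸ Set.sdiff_subset
  have hcard : (S.ncard : ℝ) / 2 ≤ K.card := by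
    have hle := Set.le_ncard_sdiff {u, w} S
    rw [← hK, Set.ncard_coe_finset, Set.ncard_pair huw] at hle
    have hle' : (S.ncard : ℝ) ≤ 2 * K.card := by exact_mod_cast (by omega)
    linarith
  have hqK : q ^ 2 * S.ncard / 4 ≤ q ^ 2 * K.card / 2 := by nlinarith [sq_nonneg q]
  have hfew : μ.real (outNeighbors K v ⁻¹' {N | (N.card : ℝ) ≤ q * K.card / 2}) ≤
      Real.exp (-(q ^ 2 * S.ncard / 8)) :=
    (real_card_outNeighbors_le_exp hμ hq0.le fun h => hv (hKS h)).trans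
      (Real.exp_le_exp.2 (by linarith [(by positivity : 0 ≤ q ^ 2 * S.ncard)]))
  have hmany := measureReal_le_add_of_forall_fiber (μ := μ) (f := outNeighbors K v)
    (fun _ => .of_discrete) {N | (N.card : ℝ) ≤ q * K.card / 2} {ω | ¬ Spreads S ω v u w}
    (ε := 6 * Real.exp (-(q ^ 2 * S.ncard / 8))) (by positivity) fun N hN => by
      rcases (outNeighbors K v ⁻¹' {N}).eq_empty_or_nonempty with hempty | ⟨ω, rfl⟩
      · simp [hempty]
      refine (real_fiber_inter_not_spreads_le hμ hq0.le hq1 hv huv huw hK.le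
        fun _ hk => (mem_outNeighbors.1 hk).1).trans ?_
      refine mul_le_mul_of_nonneg_left ?_ measureReal_nonneg
      refine two_mul_exp_mul_pow_le hq0 (hlarge.trans_eq (by congr 1; ring)) ?_
      linarith [mul_le_mul_of_nonneg_left (not_le.1 hN).le hq0.le]
  linarith

lemma real_not_spreadsOut_le (hμ : DominatesBernoulli μ (Set.diagonal V)ᶜ q) (hq0 : 0 < q)
    (hq1 : q ≤ 1) {R : ℕ} (hST : (T \ S).ncard ≤ R) (hRS : R ≤ S.ncard) (hS : 4 ≤ S.ncard)
    (hlarge : 4 / q ≤ Real.exp (q ^ 2 * S.ncard / 16)) :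
    μ.real {ω | ¬ SpreadsOut S T ω} ≤
      28 * R * (S.ncard : ℝ) ^ 2 * Real.exp (-(q ^ 2 * S.ncard / 8)) := by
  classical
  obtain ⟨J, hJ⟩ := ((T \ S) ×ˢ T ×ˢ T).toFinite.exists_finset_coe
  have hT : T.ncard ≤ 2 * S.ncard := by
    have := Set.ncard_le_ncard_sdiff_add_ncard T S
    omega
  have hJ_card : (J.card : ℝ) ≤ 4 * R * (S.ncard : ℝ) ^ 2 := by
    have hle : J.card ≤ R * (2 * S.ncard * (2 * S.ncard)) := by
      rw [← Set.ncard_coe_finset, hJ, Set.ncard_prod, Set.ncard_prod]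
      gcongr
    calc (J.card : ℝ) ≤ ((R * (2 * S.ncard * (2 * S.ncard)) : ℕ) : ℝ) := by exact_mod_cast hle
      _ = 4 * R * (S.ncard : ℝ) ^ 2 := by
          push_cast
          ring
  have hcover : {ω | ¬ SpreadsOut S T ω} ⊆
      ⋃ x ∈ J.filter fun x => x.2.1 ≠ x.1, {ω | ¬ Spreads S ω x.1 x.2.1 x.2.2} := by
    intro ω hω
    simp only [SpreadsOut, Set.mem_ofPred_eq, not_forall] at hω
    obtain ⟨v, hv, u, hu, huv, w, hw, h⟩ := hω
    have hmem : (v, u, w) ∈ (J : Set (V × V × V)) := hJ ▸ ⟨hv, hu, hw⟩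
    exact Set.mem_biUnion (x := (v, u, w)) (by simpa [huv] using hmem) h
  calc μ.real {ω | ¬ SpreadsOut S T ω}
      ≤ ∑ x ∈ J.filter fun x => x.2.1 ≠ x.1, μ.real {ω | ¬ Spreads S ω x.1 x.2.1 x.2.2} :=
        (measureReal_mono hcover (measure_ne_top _ _)).trans <|
          measureReal_biUnion_finset_le _ _
    _ ≤ (J.filter fun x => x.2.1 ≠ x.1).card • (7 * Real.exp (-(q ^ 2 * S.ncard / 8))) := by
        refine Finset.sum_le_card_nsmul _ _ _ fun x hx => ?_
        obtain ⟨hxJ, huv⟩ := Finset.mem_filter.1 hx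
        have hmem : x ∈ (T \ S) ×ˢ T ×ˢ T := hJ ▸ hxJ
        exact real_not_spreads_le hμ hq0 hq1 hmem.1.2 huv hS hlarge
    _ ≤ J.card * (7 * Real.exp (-(q ^ 2 * S.ncard / 8))) := by
        rw [nsmul_eq_mul]
        gcongr
        exact Finset.filter_subset _ _
    _ ≤ 4 * R * (S.ncard : ℝ) ^ 2 * (7 * Real.exp (-(q ^ 2 * S.ncard / 8))) := by gcongr
    _ = 28 * R * (S.ncard : ℝ) ^ 2 * Real.exp (-(q ^ 2 * S.ncard / 8)) := by ring

lemma DominatesBernoulli.map_swap {μ : Measure (Set (V × V))}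
    (hμ : DominatesBernoulli μ (Set.diagonal V)ᶜ q) :
    DominatesBernoulli (μ.map (Prod.swap ⁻¹' ·)) (Set.diagonal V)ᶜ q where
  indepMem := hμ.indepMem.map_preimage Prod.swap_injective
  le_real_mem e he := by
    rw [map_measureReal_apply .of_discrete .of_discrete]
    exact hμ.le_real_mem e.swap fun h => he h.symm

lemma real_not_spreadsOut_swap_le (hμ : DominatesBernoulli μ (Set.diagonal V)ᶜ q) (hq0 : 0 < q)
    (hq1 : q ≤ 1) {R : ℕ} (hST : (T \ S).ncard ≤ R) (hRS : R ≤ S.ncard) (hS : 4 ≤ S.ncard)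
    (hlarge : 4 / q ≤ Real.exp (q ^ 2 * S.ncard / 16)) :
    μ.real {ω | ¬ SpreadsOut S T (Prod.swap ⁻¹' ω)} ≤
      28 * R * (S.ncard : ℝ) ^ 2 * Real.exp (-(q ^ 2 * S.ncard / 8)) := by
  have := Measure.isProbabilityMeasure_map (μ := μ)
    (Measurable.of_discrete (f := fun ω : Set (V × V) => Prod.swap ⁻¹' ω)).aemeasurable
  have hle := real_not_spreadsOut_le hμ.map_swap hq0 hq1 hST hRS hS hlarge
  rwa [map_measureReal_apply .of_discrete .of_discrete] at hle

lemma real_not_grows_le (hμ : DominatesBernoulli μ (Set.diagonal V)ᶜ q) (hq0 : 0 < q)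
    (hq1 : q ≤ 1) {G₀ : Digraph V} {R : ℕ} {F : Set (Set V)} (hF : IsExhaustion G₀ R F)
    (hSF : S ∈ F) (hRS : R ≤ S.ncard) (hS : 4 ≤ S.ncard)
    (hlarge : 4 / q ≤ Real.exp (q ^ 2 * S.ncard / 16)) :
    μ.real {ω | ¬ Grows G₀ S ω} ≤ ∑ k ∈ Finset.Ico S.ncard (Nat.card V),
      56 * R * (k : ℝ) ^ 2 * Real.exp (-(q ^ 2 * k / 8)) := by
  induction hd : Nat.card V - S.ncard using Nat.strong_induction_on generalizing S with
  | _ d ih =>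
  rcases eq_or_ne S Set.univ with rfl | hSV
  · have hgrows : ∀ ω, Grows G₀ Set.univ ω := fun ω => .refl
    simp only [hgrows, not_true_eq_false, Set.ofPred_false, measureReal_empty]
    positivity
  obtain ⟨T, hTF, hST, hTS⟩ := hF.exists_ssuperset S hSF hSV
  have hlt : S.ncard < T.ncard := Set.ncard_lt_ncard hST
  have hTV : T.ncard ≤ Nat.card V := Set.ncard_le_card T
  have hT := ih _ (by omega) hTF (by omega) (by omega) (hlarge.trans (by gcongr)) rfl
  have hout := real_not_spreadsOut_le hμ hq0 hq1 hTS hRS hS hlarge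
  have hin := real_not_spreadsOut_swap_le hμ hq0 hq1 hTS hRS hS hlarge
  have hcover : {ω | ¬ Grows G₀ S ω} ⊆ ({ω | ¬ SpreadsOut S T ω} ∪
      {ω | ¬ SpreadsOut S T (Prod.swap ⁻¹' ω)}) ∪ {ω | ¬ Grows G₀ T ω} := by
    intro ω hω
    by_contra! h
    simp only [Set.mem_union, Set.mem_ofPred_eq, not_or, not_not] at h
    exact hω (.head ⟨hST.subset, hF.stronglyConnectedOn T hTF, h.1.1, h.1.2⟩ h.2)
  have htail : ∑ k ∈ Finset.Ico T.ncard (Nat.card V),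
        56 * R * (k : ℝ) ^ 2 * Real.exp (-(q ^ 2 * k / 8)) ≤
      ∑ k ∈ Finset.Ico (S.ncard + 1) (Nat.card V),
        56 * R * (k : ℝ) ^ 2 * Real.exp (-(q ^ 2 * k / 8)) :=
    Finset.sum_le_sum_of_subset_of_nonneg (Finset.Ico_subset_Ico_left hlt)
      fun _ _ _ => by positivity
  calc μ.real {ω | ¬ Grows G₀ S ω}
      ≤ μ.real {ω | ¬ SpreadsOut S T ω} + μ.real {ω | ¬ SpreadsOut S T (Prod.swap ⁻¹' ω)} +
          μ.real {ω | ¬ Grows G₀ T ω} :=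
        (measureReal_mono hcover).trans <| (measureReal_union_le _ _).trans <|
          add_le_add_left (measureReal_union_le _ _) _
    _ ≤ _ := by
        rw [Finset.sum_eq_sum_Ico_succ_bot (by omega)]
        linarith

end Spreading

section Nucleation

lemma exists_subset_le_sum_le_add_one {ι : Type*} (I : Finset ι) (f : ι → ℝ) (hf : ∀ i, f i ≤ 1)
    {g : ℝ} (hg0 : 0 ≤ g) (hg : g ≤ ∑ i ∈ I, f i) :
    ∃ J ⊆ I, g ≤ ∑ i ∈ J, f i ∧ ∑ i ∈ J, f i ≤ g + 1 := by
  classical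
  induction I using Finset.induction_on with
  | empty => exact ⟨∅, subset_rfl, hg, by simpa using by linarith⟩
  | insert a s ha ih =>
    by_cases hs : g ≤ ∑ i ∈ s, f i
    · obtain ⟨J, hJ, hsum⟩ := ih hs
      exact ⟨J, hJ.trans (Finset.subset_insert _ _), hsum⟩
    · refine ⟨insert a s, subset_rfl, hg, ?_⟩
      rw [Finset.sum_insert ha]
      linarith [hf a]

section Seeds

variable {E : Type*} [Finite E] {μ : Measure (Set E)} [IsProbabilityMeasure μ] {ι : Type*}
  {I : Finset ι} {D : ι → Set E}

lemma IndepMem.real_biInter_not_superset_le_exp (hμ : IndepMem μ)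
    (hD : (I : Set ι).PairwiseDisjoint D) :
    μ.real (⋂ i ∈ I, {ω | D i ⊆ ω}ᶜ) ≤ Real.exp (-∑ i ∈ I, μ.real {ω | D i ⊆ ω}) := by
  rw [hμ.real_biInter_eq_prod (fun i _ => (determinedBy_superset (D i)).compl) hD,
    ← Finset.sum_neg_distrib, Real.exp_sum]
  refine Finset.prod_le_prod (fun _ _ => measureReal_nonneg) fun i _ => ?_
  rw [probReal_compl_eq_one_sub .of_discrete]
  exact Real.one_sub_le_exp_neg _

lemma IndepMem.real_forall_superset_imp_mem_le (hμ : IndepMem μ)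
    (hD : (I : Set ι).PairwiseDisjoint D) {L : ι → Set (Set E)} (hL : ∀ i ∈ I, IsLowerSet (L i))
    {g δ : ℝ} (hg0 : 0 ≤ g) (hg : g ≤ ∑ i ∈ I, μ.real {ω | D i ⊆ ω}) (hδ0 : 0 ≤ δ)
    (hδ : ∀ i ∈ I, μ.real (L i) ≤ δ) :
    μ.real {ω | ∀ i ∈ I, D i ⊆ ω → ω ∈ L i} ≤ Real.exp (-g) + (g + 1) * δ := by
  obtain ⟨J, hJI, hgJ, hJg⟩ := exists_subset_le_sum_le_add_one I (fun i => μ.real {ω | D i ⊆ ω})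
    (fun _ => measureReal_le_one) hg0 hg
  have hcover : {ω | ∀ i ∈ I, D i ⊆ ω → ω ∈ L i} ⊆
      (⋂ i ∈ J, {ω | D i ⊆ ω}ᶜ) ∪ ⋃ i ∈ J, {ω | D i ⊆ ω} ∩ L i := by
    intro ω hω
    by_cases hnone : ∀ i ∈ J, ¬ D i ⊆ ω
    · exact .inl (Set.mem_iInter₂.2 hnone)
    · push Not at hnone
      obtain ⟨i, hi, hDi⟩ := hnone
      exact .inr (Set.mem_iUnion₂.2 ⟨i, hi, hDi, hω i (hJI hi) hDi⟩)
  have hnone : μ.real (⋂ i ∈ J, {ω | D i ⊆ ω}ᶜ) ≤ Real.exp (-g) :=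
    (hμ.real_biInter_not_superset_le_exp (hD.subset (Finset.coe_subset.2 hJI))).trans
      (Real.exp_le_exp.2 (neg_le_neg hgJ))
  have hsome : μ.real (⋃ i ∈ J, {ω | D i ⊆ ω} ∩ L i) ≤ (g + 1) * δ :=
    calc μ.real (⋃ i ∈ J, {ω | D i ⊆ ω} ∩ L i)
        ≤ ∑ i ∈ J, μ.real ({ω | D i ⊆ ω} ∩ L i) := measureReal_biUnion_finset_le _ _
      _ ≤ ∑ i ∈ J, μ.real {ω | D i ⊆ ω} * δ := Finset.sum_le_sum fun i hi =>
          (hμ.real_superset_inter_le _ (hL i (hJI hi))).trans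
            (mul_le_mul_of_nonneg_left (hδ i (hJI hi)) measureReal_nonneg)
      _ = (∑ i ∈ J, μ.real {ω | D i ⊆ ω}) * δ := (Finset.sum_mul _ _ _).symm
      _ ≤ (g + 1) * δ := mul_le_mul_of_nonneg_right hJg hδ0
  exact (measureReal_mono hcover (measure_ne_top _ _)).trans <|
    (measureReal_union_le _ _).trans (add_le_add hnone hsome)

end Seeds

variable {V : Type*} {S S' : Set V} {o o' : V}

lemma star_subset_compl_diagonal (S : Set V) (o : V) : star S o ⊆ (Set.diagonal V)ᶜ := by
  rintro ⟨a, b⟩ (⟨rfl, hb⟩ | ⟨ha, rfl⟩) (rfl : a = b)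
  · exact hb.2 rfl
  · exact ha.2 rfl

lemma disjoint_star (hne : o ≠ o') (h : o ∈ S' → o' ∉ S) : Disjoint (star S o) (star S' o') := by
  refine Set.disjoint_left.2 ?_
  rintro ⟨a, b⟩ (⟨rfl, hb⟩ | ⟨ha, rfl⟩) (⟨rfl, hb'⟩ | ⟨ha', rfl⟩)
  · exact hne rfl
  · exact h ha'.1 hb.1
  · exact h hb'.1 ha.1
  · exact hne rfl

lemma ncard_star_le [Finite V] (S : Set V) (o : V) : (star S o).ncard ≤ 2 * S.ncard := by
  have hle := Set.ncard_union_le ({o} ×ˢ (S \ {o})) ((S \ {o}) ×ˢ {o})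
  simp only [Set.ncard_prod, Set.ncard_singleton, one_mul, mul_one] at hle
  have hsdiff := Set.ncard_le_ncard (Set.sdiff_subset : S \ {o} ⊆ S)
  exact hle.trans (by lia)

lemma IsRUnoriented.real_not_nucleates_le [Finite V] {μ : Measure (Set (V × V))}
    [IsProbabilityMeasure μ] {q : ℝ} (hμ : DominatesBernoulli μ (Set.diagonal V)ᶜ q) (hq0 : 0 < q)
    (hq1 : q ≤ 1) {G₀ : Digraph V} {R m : ℕ} (hG₀ : IsRUnoriented R G₀) (hRm : R ≤ m) (hm : 4 ≤ m)
    (hlarge : 4 / q ≤ Real.exp (q ^ 2 * m / 16)) {g δ : ℝ} (hg0 : 0 ≤ g)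
    (hg : g ≤ ((Nat.card V : ℝ) / R - m) * q ^ (2 * (R * m)))
    (hδ : ∑ k ∈ Finset.Ico m (Nat.card V), 56 * R * (k : ℝ) ^ 2 * Real.exp (-(q ^ 2 * k / 8)) ≤
      δ) :
    μ.real {ω | ¬ Nucleates G₀ ω} ≤ Real.exp (-g) + (g + 1) * δ := by
  obtain ⟨F, I, B, hF, hB, hcard⟩ :=
    hG₀.exists_isExhaustion_isCentredFamily (show 1 ≤ m by lia)
  have hI : (Nat.card V : ℝ) / R - m ≤ I.card := by
    refine sub_le_iff_le_add.2 (div_le_of_le_mul₀ (by positivity) (by positivity) ?_)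
    rw [mul_comm]
    exact_mod_cast hcard
  have hstar : ∀ o ∈ I, q ^ (2 * (R * m)) ≤ μ.real {ω | star (B o) o ⊆ ω} := fun o ho =>
    (pow_le_pow_of_le_one hq0.le hq1 ((ncard_star_le _ _).trans
      (Nat.mul_le_mul_left 2 (hB.ncard_le o ho)))).trans
      (hμ.pow_ncard_le_real_superset hq0.le (star_subset_compl_diagonal _ _))
  have hgrows : ∀ o ∈ I, μ.real {ω | ¬ Grows G₀ (B o) ω} ≤ δ := fun o ho => by
    have hmB := hB.le_ncard o ho
    refine (real_not_grows_le hμ hq0 hq1 hF (hB.mem_family o ho) (hRm.trans hmB) (hm.trans hmB)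
      (hlarge.trans (by gcongr))).trans (le_trans ?_ hδ)
    exact Finset.sum_le_sum_of_subset_of_nonneg (Finset.Ico_subset_Ico_left hmB)
      fun _ _ _ => by positivity
  have hfail : {ω | ¬ Nucleates G₀ ω} ⊆
      {ω | ∀ o ∈ I, star (B o) o ⊆ ω → ω ∈ {ω | ¬ Grows G₀ (B o) ω}} :=
    fun ω hω o ho hsub hgrow => hω ⟨B o, hF.stronglyConnectedOn _ (hB.mem_family o ho),
      ⟨o, hB.mem o ho, hsub⟩, hgrow⟩
  refine (measureReal_mono hfail (measure_ne_top _ _)).trans <|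
    hμ.indepMem.real_forall_superset_imp_mem_le (D := fun o => star (B o) o)
      (L := fun o => {ω | ¬ Grows G₀ (B o) ω})
      (fun o ho o' ho' hne => disjoint_star hne fun h h' => hne (hB.antisymm o ho o' ho' h h'))
      (fun o _ ω ω' hω h hgrow => h (hgrow.mono hω)) hg0 (hg.trans ?_)
      (le_trans (by positivity) hδ) hgrows
  calc ((Nat.card V : ℝ) / R - m) * q ^ (2 * (R * m)) ≤ I.card • q ^ (2 * (R * m)) := by
        rw [nsmul_eq_mul]
        gcongr
    _ ≤ ∑ o ∈ I, μ.real {ω | star (B o) o ⊆ ω} := Finset.card_nsmul_le_sum _ _ _ hstar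

/-- The law of the random set of edges that are open or initially occupied. -/
noncomputable def permittedLaw (G₀ : Digraph V) (p : unitInterval) : Measure (Set (V × V)) :=
  (openLaw G₀ p).map (edges G₀ ∪ ·)

variable (G₀ : Digraph V) (p : unitInterval)

instance : IsProbabilityMeasure (openLaw G₀ p) := by
  unfold openLaw
  infer_instance

variable [Finite V]

instance : IsProbabilityMeasure (permittedLaw G₀ p) :=
  Measure.isProbabilityMeasure_map Measurable.of_discrete.aemeasurable

lemma dominatesBernoulli_permittedLaw :
    DominatesBernoulli (permittedLaw G₀ p) (Set.diagonal V)ᶜ p where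
  indepMem := (indepMem_setBernoulli p (candidateEdges G₀)).map_union_left (edges G₀)
  le_real_mem e he := by
    rw [permittedLaw, map_measureReal_apply .of_discrete .of_discrete]
    by_cases heG₀ : e ∈ edges G₀
    · have huniv : (edges G₀ ∪ ·) ⁻¹' {ω : Set (V × V) | e ∈ ω} = Set.univ :=
        Set.eq_univ_of_forall fun _ => .inl heG₀
      rw [huniv, probReal_univ]
      exact p.2.2
    · rw [← setBernoulli_real_mem p (candidateEdges G₀) ⟨he, heG₀⟩]
      exact measureReal_mono fun _ hω => .inr hω

lemma one_sub_real_not_nucleates_le :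
    1 - (permittedLaw G₀ p).real {ω | ¬ Nucleates G₀ ω} ≤
      (openLaw G₀ p).real {E | IsSaturated G₀ E Set.univ} := by
  have hsub : {E | IsSaturated G₀ E Set.univ}ᶜ ≤ᵐ[openLaw G₀ p]
      (edges G₀ ∪ ·) ⁻¹' {ω | ¬ Nucleates G₀ ω} := by
    filter_upwards [(setBernoulli_ae_subset : ∀ᵐ E ∂openLaw G₀ p, E ⊆ candidateEdges G₀)]
      with E hE hsat hnucleates
    exact hsat (hnucleates.isSaturated hE)
  rw [permittedLaw, map_measureReal_apply .of_discrete .of_discrete, sub_le_comm,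
    ← probReal_compl_eq_one_sub .of_discrete]
  exact ENNReal.toReal_mono (measure_ne_top _ _) (measure_mono_ae hsub)

end Nucleation

section Asymptotics

lemma sq_mul_exp_neg_le {c : ℝ} (hc : 0 < c) {x : ℝ} (hx : 0 ≤ x) :
    x ^ 2 * Real.exp (-(c * x)) ≤ 16 / c ^ 2 * Real.exp (-(c * x / 2)) := by
  have hsq : (c * x / 4) ^ 2 ≤ Real.exp (c * x / 2) :=
    calc (c * x / 4) ^ 2 ≤ Real.exp (c * x / 4) ^ 2 := by
          gcongr
          linarith [Real.add_one_le_exp (c * x / 4)]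
      _ = Real.exp (c * x / 2) := by
          rw [← Real.exp_nat_mul]
          push_cast
          ring_nf
  calc x ^ 2 * Real.exp (-(c * x)) = 16 / c ^ 2 * ((c * x / 4) ^ 2 * Real.exp (-(c * x))) := by
        field_simp
        ring
    _ ≤ 16 / c ^ 2 * (Real.exp (c * x / 2) * Real.exp (-(c * x))) := by gcongr
    _ = 16 / c ^ 2 * Real.exp (-(c * x / 2)) := by
        rw [← Real.exp_add]
        ring_nf

lemma exp_neg_half_le {c : ℝ} (hc0 : 0 ≤ c) (hc1 : c ≤ 1) : Real.exp (-(c / 2)) ≤ 1 - c / 4 := by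
  rw [Real.exp_neg]
  refine inv_le_of_inv_le₀ (by linarith) (le_trans ?_ (Real.add_one_le_exp (c / 2)))
  rw [inv_le_iff_one_le_mul₀ (by linarith)]
  nlinarith

lemma sum_sq_mul_exp_le {c : ℝ} (hc0 : 0 < c) (hc1 : c ≤ 1) (m n : ℕ) :
    ∑ k ∈ Finset.Ico m n, (k : ℝ) ^ 2 * Real.exp (-(c * k)) ≤
      64 / c ^ 3 * Real.exp (-(c * m / 2)) := by
  set r := Real.exp (-(c / 2)) with hr
  have hr1 : r ≤ 1 - c / 4 := exp_neg_half_le hc0.le hc1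
  have hpow (k : ℕ) : Real.exp (-(c * k / 2)) = r ^ k := by
    rw [hr, ← Real.exp_nat_mul]
    ring_nf
  calc ∑ k ∈ Finset.Ico m n, (k : ℝ) ^ 2 * Real.exp (-(c * k))
      ≤ ∑ k ∈ Finset.Ico m n, 16 / c ^ 2 * r ^ k := Finset.sum_le_sum fun k _ =>
        (sq_mul_exp_neg_le hc0 k.cast_nonneg).trans_eq (by rw [hpow])
    _ = 16 / c ^ 2 * ∑ k ∈ Finset.Ico m n, r ^ k := (Finset.mul_sum _ _ _).symm
    _ ≤ 16 / c ^ 2 * (r ^ m / (1 - r)) := by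
        gcongr
        exact geom_sum_Ico_le_of_lt_one (Real.exp_pos _).le (by linarith)
    _ ≤ 16 / c ^ 2 * (r ^ m / (c / 4)) := by
        gcongr
        linarith
    _ = 64 / c ^ 3 * Real.exp (-(c * m / 2)) := by
        rw [hpow]
        field_simp
        ring

/-- The lower bound on the edge probability, as a function of `X = log n`. -/
noncomputable def edgeProb (R : ℕ) (X : ℝ) : ℝ := 32 * R * Real.log X / √X

/-- The size of the blocks among which a nucleus is sought, as a function of `X = log n`: it is
large enough for a block with an open star to spread over the whole graph, and small enough for an
open star to occur among `n / (R * blockSize R X)` disjoint attempts. -/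
noncomputable def blockSize (R : ℕ) (X : ℝ) : ℕ := ⌈X / (8 * R * Real.log X)⌉₊

variable {R : ℕ} {X : ℝ}

lemma edgeProb_le_one (hlX : 32 * R * Real.log X ≤ √X) : edgeProb R X ≤ 1 :=
  div_le_one_of_le₀ hlX (Real.sqrt_nonneg X)

lemma one_le_mul_log (hR : 1 ≤ R) (hl : 1 ≤ Real.log X) : 1 ≤ R * Real.log X :=
  one_le_mul_of_one_le_of_one_le (by exact_mod_cast hR) hl

lemma mul_le_sqrt (hl : 1 ≤ Real.log X) (hlX : 32 * R * Real.log X ≤ √X) : 32 * R ≤ √X :=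
  (le_mul_of_one_le_right (by positivity) hl).trans hlX

lemma pos_of_mul_log_le_sqrt (hR : 1 ≤ R) (hl : 1 ≤ Real.log X)
    (hlX : 32 * R * Real.log X ≤ √X) : 0 < X :=
  Real.sqrt_pos.1 (by linarith [one_le_mul_log hR hl])

lemma mul_sqrt_le (hR : 1 ≤ R) (hl : 1 ≤ Real.log X) (hlX : 32 * R * Real.log X ≤ √X) :
    32 * √X ≤ X := by
  nth_rw 2 [← Real.mul_self_sqrt (pos_of_mul_log_le_sqrt hR hl hlX).le]
  gcongr
  linarith [one_le_mul_log hR hl]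

lemma inv_sqrt_le_edgeProb (hR : 1 ≤ R) (hl : 1 ≤ Real.log X) : (√X)⁻¹ ≤ edgeProb R X := by
  rw [inv_eq_one_div, edgeProb]
  gcongr
  linarith [one_le_mul_log hR hl]

lemma edgeProb_pos (hR : 1 ≤ R) (hl : 1 ≤ Real.log X) (hlX : 32 * R * Real.log X ≤ √X) :
    0 < edgeProb R X :=
  (inv_pos.2 (Real.sqrt_pos.2 (pos_of_mul_log_le_sqrt hR hl hlX))).trans_le
    (inv_sqrt_le_edgeProb hR hl)

lemma inv_edgeProb_le_sqrt (hR : 1 ≤ R) (hl : 1 ≤ Real.log X)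
    (hlX : 32 * R * Real.log X ≤ √X) : (edgeProb R X)⁻¹ ≤ √X :=
  inv_le_of_inv_le₀ (Real.sqrt_pos.2 (pos_of_mul_log_le_sqrt hR hl hlX))
    (inv_sqrt_le_edgeProb hR hl)

lemma sqrt_le_blockSize (hR : 1 ≤ R) (hl : 1 ≤ Real.log X) (hlX : 32 * R * Real.log X ≤ √X) :
    √X ≤ blockSize R X := by
  have hRl := one_le_mul_log hR hl
  refine le_trans ?_ (Nat.le_ceil _)
  rw [le_div_iff₀ (by linarith)]
  calc √X * (8 * R * Real.log X) ≤ √X * √X := by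
        gcongr
        linarith
    _ = X := Real.mul_self_sqrt (pos_of_mul_log_le_sqrt hR hl hlX).le

lemma mul_blockSize_le (hR : 1 ≤ R) (hl : 1 ≤ Real.log X) (hlX : 32 * R * Real.log X ≤ √X) :
    R * Real.log X * blockSize R X ≤ X / 4 := by
  have hX := pos_of_mul_log_le_sqrt hR hl hlX
  have hRl := one_le_mul_log hR hl
  calc R * Real.log X * blockSize R X ≤ R * Real.log X * (X / (8 * R * Real.log X) + 1) := by
        gcongr
        exact (Nat.ceil_lt_add_one (div_nonneg hX.le (by linarith))).le
    _ = X / 8 + R * Real.log X := by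
        have hR0 : (R : ℝ) ≠ 0 := by positivity
        field_simp
    _ ≤ X / 4 := by linarith [mul_sqrt_le hR hl hlX]

lemma mul_log_le_edgeProb_sq_mul_blockSize (hR : 1 ≤ R) (hl : 1 ≤ Real.log X)
    (hlX : 32 * R * Real.log X ≤ √X) :
    128 * Real.log X ≤ edgeProb R X ^ 2 * blockSize R X := by
  have hX := pos_of_mul_log_le_sqrt hR hl hlX
  calc 128 * Real.log X ≤ 128 * R * Real.log X := by
        gcongr
        exact le_mul_of_one_le_right (by norm_num) (by exact_mod_cast hR)
    _ = edgeProb R X ^ 2 * (X / (8 * R * Real.log X)) := by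
        have hR0 : (R : ℝ) ≠ 0 := by positivity
        rw [edgeProb, div_pow, Real.sq_sqrt hX.le]
        field_simp
        norm_num
    _ ≤ edgeProb R X ^ 2 * blockSize R X := by
        gcongr
        exact Nat.le_ceil _

lemma pow_le_exp_edgeProb_sq_mul_blockSize (hR : 1 ≤ R) (hl : 1 ≤ Real.log X)
    (hlX : 32 * R * Real.log X ≤ √X) :
    X ^ 8 ≤ Real.exp (edgeProb R X ^ 2 * blockSize R X / 16) := by
  calc X ^ 8 = Real.exp ((8 : ℕ) * Real.log X) := by
        rw [Real.exp_nat_mul, Real.exp_log (pos_of_mul_log_le_sqrt hR hl hlX)]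
    _ ≤ Real.exp (edgeProb R X ^ 2 * blockSize R X / 16) := by
        refine Real.exp_le_exp.2 ?_
        push_cast
        linarith [mul_log_le_edgeProb_sq_mul_blockSize hR hl hlX]

lemma four_div_edgeProb_le (hR : 1 ≤ R) (hl : 1 ≤ Real.log X) (hlX : 32 * R * Real.log X ≤ √X) :
    4 / edgeProb R X ≤ Real.exp (edgeProb R X ^ 2 * blockSize R X / 16) := by
  have hsqrt := mul_sqrt_le hR hl hlX
  have hRl := one_le_mul_log hR hl
  calc 4 / edgeProb R X ≤ 4 * √X := by
        rw [div_eq_mul_inv]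
        gcongr
        exact inv_edgeProb_le_sqrt hR hl hlX
    _ ≤ X := by linarith [Real.sqrt_nonneg X]
    _ ≤ X ^ 8 := le_self_pow₀ (by linarith) (by norm_num)
    _ ≤ _ := pow_le_exp_edgeProb_sq_mul_blockSize hR hl hlX

lemma exp_neg_le_edgeProb_pow (hR : 1 ≤ R) (hl : 1 ≤ Real.log X)
    (hlX : 32 * R * Real.log X ≤ √X) :
    Real.exp (-(X / 4)) ≤ edgeProb R X ^ (2 * (R * blockSize R X)) := by
  have hX := pos_of_mul_log_le_sqrt hR hl hlX
  calc Real.exp (-(X / 4)) ≤ Real.exp (-(R * Real.log X * blockSize R X)) :=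
        Real.exp_le_exp.2 (neg_le_neg (mul_blockSize_le hR hl hlX))
    _ = (√X)⁻¹ ^ (2 * (R * blockSize R X)) := by
        rw [pow_mul, inv_pow, Real.sq_sqrt hX.le, ← Real.exp_log (inv_pos.2 hX), Real.log_inv,
          ← Real.exp_nat_mul]
        push_cast
        ring_nf
    _ ≤ edgeProb R X ^ (2 * (R * blockSize R X)) := by
        gcongr
        exact inv_sqrt_le_edgeProb hR hl

lemma exp_half_le_exp_div_sub_blockSize (hR : 1 ≤ R) (hl : 1 ≤ Real.log X)
    (hlX : 32 * R * Real.log X ≤ √X) :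
    Real.exp (X / 2) ≤ Real.exp X / R - blockSize R X := by
  have hblock : (blockSize R X : ℝ) ≤ X / 4 :=
    (le_mul_of_one_le_left (Nat.cast_nonneg _) (one_le_mul_log hR hl)).trans
      (mul_blockSize_le hR hl hlX)
  have hexp := Real.add_one_le_exp (X / 2)
  have hR' : 2 * (R : ℝ) ≤ Real.exp (X / 2) := by
    linarith [mul_le_sqrt hl hlX, mul_sqrt_le hR hl hlX, pos_of_mul_log_le_sqrt hR hl hlX]
  have hdiv : 2 * Real.exp (X / 2) ≤ Real.exp X / R := by
    rw [le_div_iff₀ (by positivity)]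
    calc 2 * Real.exp (X / 2) * R = 2 * R * Real.exp (X / 2) := by ring
      _ ≤ Real.exp (X / 2) * Real.exp (X / 2) := by gcongr
      _ = Real.exp X := by rw [← Real.exp_add, add_halves]
  linarith [pos_of_mul_log_le_sqrt hR hl hlX]

lemma le_exp_div_sub_blockSize_mul_edgeProb_pow (hR : 1 ≤ R) (hl : 1 ≤ Real.log X)
    (hlX : 32 * R * Real.log X ≤ √X) :
    X ≤ (Real.exp X / R - blockSize R X) * edgeProb R X ^ (2 * (R * blockSize R X)) := by
  have hX := pos_of_mul_log_le_sqrt hR hl hlX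
  have hX16 : 32 ≤ X := by
    linarith [mul_sqrt_le hR hl hlX, one_le_mul_log hR hl]
  have hnonneg := (Real.exp_pos _).le.trans (exp_half_le_exp_div_sub_blockSize hR hl hlX)
  calc X ≤ Real.exp (X / 4) := by
        nlinarith [Real.quadratic_le_exp_of_nonneg (show 0 ≤ X / 4 by positivity)]
    _ = Real.exp (X / 2) * Real.exp (-(X / 4)) := by
        rw [← Real.exp_add]
        ring_nf
    _ ≤ _ := mul_le_mul (exp_half_le_exp_div_sub_blockSize hR hl hlX)
        (exp_neg_le_edgeProb_pow hR hl hlX) (Real.exp_pos _).le hnonneg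

lemma sum_not_grows_bound_le (hR : 1 ≤ R) (hl : 1 ≤ Real.log X) (hlX : 32 * R * Real.log X ≤ √X)
    (n : ℕ) :
    ∑ k ∈ Finset.Ico (blockSize R X) n,
      56 * R * (k : ℝ) ^ 2 * Real.exp (-(edgeProb R X ^ 2 * k / 8)) ≤ 1835008 * R / X ^ 5 := by
  have hX := pos_of_mul_log_le_sqrt hR hl hlX
  have hq0 := edgeProb_pos hR hl hlX
  have hq1 := pow_le_one₀ (n := 2) hq0.le (edgeProb_le_one hlX)
  have hqX : (edgeProb R X ^ 2)⁻¹ ≤ X := by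
    rw [← inv_pow]
    exact (pow_le_pow_left₀ (inv_pos.2 hq0).le (inv_edgeProb_le_sqrt hR hl hlX) 2).trans_eq
      (Real.sq_sqrt hX.le)
  calc ∑ k ∈ Finset.Ico (blockSize R X) n,
        56 * R * (k : ℝ) ^ 2 * Real.exp (-(edgeProb R X ^ 2 * k / 8))
      = 56 * R * ∑ k ∈ Finset.Ico (blockSize R X) n,
          (k : ℝ) ^ 2 * Real.exp (-(edgeProb R X ^ 2 / 8 * k)) := by
        rw [Finset.mul_sum]
        exact Finset.sum_congr rfl fun k _ => by ring_nf
    _ ≤ 56 * R * (64 / (edgeProb R X ^ 2 / 8) ^ 3 *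
          Real.exp (-(edgeProb R X ^ 2 / 8 * blockSize R X / 2))) := by
        gcongr
        exact sum_sq_mul_exp_le (by positivity) (by linarith) _ _
    _ = 1835008 * R * ((edgeProb R X ^ 2)⁻¹ ^ 3 *
          (Real.exp (edgeProb R X ^ 2 * blockSize R X / 16))⁻¹) := by
        rw [← Real.exp_neg]
        field_simp
        ring_nf
    _ ≤ 1835008 * R * (X ^ 3 * (X ^ 8)⁻¹) := by
        gcongr
        exact pow_le_exp_edgeProb_sq_mul_blockSize hR hl hlX
    _ = 1835008 * R / X ^ 5 := by field_simp

lemma IsRUnoriented.le_openLaw_real_isSaturated {V : Type*} [Finite V] {G₀ : Digraph V}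
    (hG₀ : IsRUnoriented R G₀) (hV : (Nat.card V : ℝ) = Real.exp X) (hR : 1 ≤ R)
    (hl : 1 ≤ Real.log X) (hlX : 32 * R * Real.log X ≤ √X) {p : unitInterval}
    (hp : edgeProb R X ≤ p) :
    1 - (Real.exp (-X) + (X + 1) * (1835008 * R / X ^ 5)) ≤
      (openLaw G₀ p).real {E | IsSaturated G₀ E Set.univ} := by
  have hRm : 32 * R ≤ blockSize R X := by
    exact_mod_cast (mul_le_sqrt hl hlX).trans (sqrt_le_blockSize hR hl hlX)
  refine le_trans (sub_le_sub_left ?_ 1) (one_sub_real_not_nucleates_le G₀ p)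
  exact hG₀.real_not_nucleates_le ((dominatesBernoulli_permittedLaw G₀ p).mono hp)
    (edgeProb_pos hR hl hlX) (edgeProb_le_one hlX) (by lia) (by lia)
    (four_div_edgeProb_le hR hl hlX) (pos_of_mul_log_le_sqrt hR hl hlX).le
    (hV ▸ le_exp_div_sub_blockSize_mul_edgeProb_pow hR hl hlX)
    (sum_not_grows_bound_le hR hl hlX _)

lemma eventually_mul_log_le_sqrt (K : ℝ) : ∀ᶠ X : ℝ in atTop, K * Real.log X ≤ √X := by
  have h := ((isLittleO_log_rpow_atTop (show (0 : ℝ) < 1 / 2 by norm_num)).const_mul_left K).bound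
    one_pos
  filter_upwards [h] with X hX
  rw [one_mul, ← Real.sqrt_eq_rpow, Real.norm_of_nonneg (Real.sqrt_nonneg X)] at hX
  exact (le_abs_self _).trans hX

lemma tendsto_one_sub_failure_bound (K : ℝ) :
    Tendsto (fun X : ℝ => 1 - (Real.exp (-X) + (X + 1) * (K / X ^ 5))) atTop (𝓝 1) := by
  have hpow (k : ℕ) (hk : k ≠ 0) : Tendsto (fun X : ℝ => (X ^ k)⁻¹) atTop (𝓝 0) :=
    tendsto_inv_atTop_zero.comp (tendsto_pow_atTop hk)
  have hlim : Tendsto (fun X : ℝ => 1 - (Real.exp (-X) + K * ((X ^ 4)⁻¹ + (X ^ 5)⁻¹))) atTop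
      (𝓝 (1 - (0 + K * (0 + 0)))) :=
    (Real.tendsto_exp_neg_atTop_nhds_zero.add
      (((hpow 4 four_ne_zero).add (hpow 5 (by norm_num))).const_mul K)).const_sub 1
  simp only [add_zero, mul_zero, sub_zero] at hlim
  refine hlim.congr' ?_
  filter_upwards [eventually_ne_atTop 0] with X hX
  field_simp

end Asymptotics

end TransClosure

theorem mainTheorem6 :
    ∀ R : ℕ, 1 ≤ R → ∃ C₀ : ℝ, ∀ C : ℝ, C₀ ≤ C →
      ∀ (G₀ : (n : ℕ) → Digraph (Fin n)) (p : ℕ → unitInterval),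
        (∀ᶠ n : ℕ in atTop, TransClosure.IsRUnoriented R (G₀ n)) →
        (∀ᶠ n : ℕ in atTop,
          C * Real.log (Real.log (n : ℝ)) / Real.sqrt (Real.log (n : ℝ)) ≤ (p n : ℝ)) →
        Tendsto
          (fun n : ℕ => (TransClosure.openLaw (G₀ n) (p n)).real
            {Eopen | TransClosure.IsSaturated (G₀ n) Eopen Set.univ})
          atTop (𝓝 1) := by
  intro R hR
  refine ⟨32 * R, fun C hC G₀ p hG₀ hp => ?_⟩
  have hlog : Tendsto (fun n : ℕ => Real.log (n : ℝ)) atTop atTop :=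
    Real.tendsto_log_atTop.comp tendsto_natCast_atTop_atTop
  refine tendsto_of_tendsto_of_tendsto_of_le_of_le'
    ((TransClosure.tendsto_one_sub_failure_bound (1835008 * R)).comp hlog) tendsto_const_nhds ?_
    (Eventually.of_forall fun n => measureReal_le_one)
  filter_upwards [hG₀, hp, (Real.tendsto_log_atTop.comp hlog).eventually_ge_atTop 1,
    hlog.eventually (TransClosure.eventually_mul_log_le_sqrt (32 * R)), eventually_gt_atTop 0]
    with n hG₀n hpn hloglog hsqrt hn
  simp only [Function.comp_apply] at hloglog
  have hcard : (Nat.card (Fin n) : ℝ) = Real.exp (Real.log n) := by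
    rw [Nat.card_fin, Real.exp_log (by exact_mod_cast hn)]
  have hprob : TransClosure.edgeProb R (Real.log n) ≤ p n := by
    refine le_trans ?_ hpn
    rw [TransClosure.edgeProb]
    gcongr
  exact hG₀n.le_openLaw_real_isSaturated hcard hR hloglog hsqrt hprob
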